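/- Let $r_0,r_1,\dots$ be a Markov chain in $\{1,\dots,K\}$ with initial law $p^1(r_0)$ and transitions $p^1(r_i|r_{i-1})$. Let $p^1$ be the linear and Gaussian jump Markov state space system with states $x_i\in\mathbb R^m$, observations $y_i\in\mathbb R^p$, $z_i=(x_i,y_i)$: $$p^1(z_{0:k},r_{0:k})=p^1(r_0)\prod_{i=1}^k p^1(r_i|r_{i-1})\;p^1(x_0|r_0)\prod_{i=1}^k f_{i|i-1}(x_i|x_{i-1},r_i)\prod_{i=0}^k g_i(y_i|x_i,r_i),$$ where $p^1(x_0|r_0)=\mathcal N(x_0;m_0(r_0);P_0(r_0))$, $f_{i|i-1}(x_i|x_{i-1},r_i)=\mathcal N(x_i;F_i(r_i)x_{i-1};Q_i(r_i))$, $g_i(y_i|x_i,r_i)=\mathcal N(y_i;H_i(r_i)x_i;R_i(r_i))$, and all the covariance matrices $P_0(\cdot)$, $Q_i(\cdot)$, $R_i(\cdot)$ are positive definite. For matrices $\theta=\{(F_i^2(r_{i-1},r_i),H_i^2(r_{i-1},r_i))\}_{i\ge1}$ of sizes $m\times p$ and $p\times p$, let $$p^{2,\theta}(z_{0:k},r_{0:k})=p^1(r_0)\prod_{i=1}^k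 p^1(r_i|r_{i-1})\;p^1(x_0|r_0)\,g_0(y_0|x_0,r_0)\prod_{i=1}^k \mathcal N\big(z_i;B_i z_{i-1};\Sigma_i\big),$$ where (with arguments $r_{i-1}$, $r_i$ of $F_i^2,H_i^2,B_i,\Sigma_i$, argument $r_{i-1}$ of $H_{i-1},R_{i-1}$, and argument $r_i$ of $F_i,H_i,Q_i,R_i$ understood) $$B_i=\begin{bmatrix}F_i-F_i^2H_{i-1}&F_i^2\\ H_iF_i-H_i^2H_{i-1}&H_i^2\end{bmatrix},\qquad \Sigma_i=\begin{bmatrix}Q_i-F_i^2R_{i-1}(F_i^2)^T&\big(H_iQ_i-H_i^2R_{i-1}(F_i^2)^T\big)^T\\ H_iQ_i-H_i^2R_{i-1}(F_i^2)^T&R_i-H_i^2R_{i-1}(H_i^2)^T+H_iQ_iH_i^T\end{bmatrix}.$$ Let $\Theta$ be the set of those $\theta$ for which, for all $i\ge1$ and all pairs of regimes, $\Sigma_i$ is positive definite and $H_iF_i-H_i^2H_{i-1}=0$. For given $H^2$ put $$F_i^{2,\mathrm{opt}}(r_{i-1},r_i)=Q_i(r_i)H_i(r_i)^T\big[R_i(r_i)+H_i(r_i)Q_i(r_i)H_i(r_i)^T\big]^{-1}H_i^2(r_{i-1},r_i).$$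 1. Let $H^2$ be such that $(F^2,H^2)\in\Theta$ for some $F^2$. Then $(F^{2,\mathrm{opt}},H^2)\in\Theta$, and for every $k\ge 0$ the divergence $D_{\mathrm{KL}}(p^{2,\theta}(z_{0:k},r_{0:k}),p^1(z_{0:k},r_{0:k}))$ is finite at $\theta=(F^{2,\mathrm{opt}},H^2)$. Moreover, a parameter $F^2$ with $(F^2,H^2)\in\Theta$ minimizes this divergence over $\{F^2:(F^2,H^2)\in\Theta\}$ if and only if $F_i^2(r_{i-1},r_i)=F_i^{2,\mathrm{opt}}(r_{i-1},r_i)$ for all $1\le i\le k$ and all pairs $(r_{i-1},r_i)$ that have positive probability under $p^1$. 2. If $(F^2,H^2)$ minimizes the divergence over the whole of $\Theta$ (jointly in $F^2$ and $H^2$), for some $k\ge 0$, then $F^2_i(r_{i-1},r_i)=F_i^{2,\mathrm{opt}}(r_{i-1},r_i)$ for the same $i$ and pairs $(r_{i-1},r_i)$, where $F^{2,\mathrm{opt}}$ is formed with this $H^2$. -/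

import Mathlib

open MeasureTheory ProbabilityTheory InformationTheory
open scoped Matrix ENNReal

noncomputable section

namespace JumpPMC

/-- The space `ℝⁿ` with its Euclidean structure. -/
abbrev Vec (n : ℕ) : Type := EuclideanSpace ℝ (Fin n)

/-! ### Gaussian and regime kernels -/

lemma measurable_multivariateGaussian {ι : Type} [Fintype ι] [DecidableEq ι] (S : Matrix ι ι ℝ) :
    Measurable fun v : EuclideanSpace ℝ ι => multivariateGaussian v S := by
  have key (L : EuclideanSpace ℝ ι →L[ℝ] EuclideanSpace ℝ ι) :
      Measurable fun v => (stdGaussian (EuclideanSpace ℝ ι)).map fun x => v + L x := by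
    have h : Measurable fun q : EuclideanSpace ℝ ι × EuclideanSpace ℝ ι => q.1 + L q.2 := by
      fun_prop
    have h2 := (Measure.measurable_map _ h).comp
      (Measurable.map_prodMk_left (α := EuclideanSpace ℝ ι)
        (ν := stdGaussian (EuclideanSpace ℝ ι)))
    refine (congrArg Measurable (funext fun v => ?_)).mp h2
    exact Measure.map_map h measurable_prodMk_left
  exact key _

/-- The kernel `(u, c) ↦ 𝒩(A c u, S c)`: a Gaussian whose mean is linear in `u`, and whose
matrices depend on a discrete variable `c`. -/
def gaussKernel {ι κ C : Type} [Fintype ι] [DecidableEq ι] [Fintype κ] [Countable C]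
    [MeasurableSpace C] [MeasurableSingletonClass C]
    (A : C → Matrix ι κ ℝ) (S : C → Matrix ι ι ℝ) :
    Kernel (EuclideanSpace ℝ κ × C) (EuclideanSpace ℝ ι) where
  toFun u := multivariateGaussian (WithLp.toLp 2 (A u.2 *ᵥ WithLp.ofLp u.1)) (S u.2)
  measurable' := by
    refine measurable_from_prod_countable_left fun c => ?_
    refine (measurable_multivariateGaussian (S c)).comp ?_
    refine (WithLp.measurable_toLp 2 (ι → ℝ)).comp ?_
    have h : Continuous fun v : κ → ℝ => A c *ᵥ v := by fun_prop
    exact h.measurable.comp (WithLp.measurable_ofLp 2 (κ → ℝ))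

instance {ι κ C : Type} [Fintype ι] [DecidableEq ι] [Fintype κ] [Countable C]
    [MeasurableSpace C] [MeasurableSingletonClass C]
    (A : C → Matrix ι κ ℝ) (S : C → Matrix ι ι ℝ) : IsMarkovKernel (gaussKernel A S) :=
  ⟨fun _ => inferInstanceAs (IsProbabilityMeasure (multivariateGaussian _ _))⟩

/-- The kernel of a finite transition matrix, given by its rows. -/
def regimeKernel {K : ℕ} (T : Fin K → PMF (Fin K)) : Kernel (Fin K) (Fin K) :=
  Kernel.ofFunOfCountable fun r => (T r).toMeasure

instance {K : ℕ} (T : Fin K → PMF (Fin K)) : IsMarkovKernel (regimeKernel T) :=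
  ⟨fun r => inferInstanceAs (IsProbabilityMeasure ((T r).toMeasure))⟩

/-! ### Law of the trajectory of a Markov chain -/

/-- Law of `(s_0, …, s_k)` for the Markov chain with initial law `μ` and with transition
`κ i` from time `i` to time `i + 1`. -/
def pathLaw {S : Type} [MeasurableSpace S] (μ : Measure S) (κ : ℕ → Kernel S S) :
    (k : ℕ) → Measure (Fin (k + 1) → S)
  | 0 => μ.map fun s _ => s
  | k + 1 =>
      (pathLaw μ κ k ⊗ₘ (κ k).comap (fun t => t (Fin.last k)) (measurable_pi_apply _)).map
        fun q => Fin.snoc (α := fun _ => S) q.1 q.2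

lemma measurable_snoc {S : Type} [MeasurableSpace S] (k : ℕ) :
    Measurable fun q : (Fin (k + 1) → S) × S =>
      (Fin.snoc (α := fun _ => S) q.1 q.2 : Fin (k + 1 + 1) → S) := by
  refine measurable_pi_lambda _ fun i => ?_
  refine Fin.lastCases ?_ (fun j => ?_) i
  · simpa using measurable_snd
  · simp only [Fin.snoc_castSucc]; fun_prop

/-- Sanity check: the law of a trajectory is a probability measure. -/
instance isProbabilityMeasure_pathLaw {S : Type} [MeasurableSpace S] (μ : Measure S)
    [IsProbabilityMeasure μ] (κ : ℕ → Kernel S S) [∀ i, IsMarkovKernel (κ i)] (k : ℕ) :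
    IsProbabilityMeasure (pathLaw μ κ k) := by
  induction k with
  | zero =>
    exact Measure.isProbabilityMeasure_map
      (measurable_pi_lambda _ fun _ => measurable_id).aemeasurable
  | succ k ih => exact Measure.isProbabilityMeasure_map (measurable_snoc k).aemeasurable

/-! ### Linear and Gaussian jump Markov state space systems -/

/-- Parameters of a linear and Gaussian jump Markov state space system with regimes
`r_k ∈ {1, …, K}`, states `x_k ∈ ℝᵐ` and observations `y_k ∈ ℝᵖ`. -/
structure JMSS (K m p : ℕ) where
  /-- law of `r_0` -/
  initRegime : PMF (Fin K)
  /-- `trans i r` is the law of `r_{i+1}` given `r_i = r` -/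
  trans : ℕ → Fin K → PMF (Fin K)
  /-- mean of `x_0` given `r_0` -/
  m0 : Fin K → Vec m
  /-- covariance of `x_0` given `r_0` -/
  P0 : Fin K → Matrix (Fin m) (Fin m) ℝ
  /-- `x_i` given `x_{i-1}, r_i` is `𝒩(F_i(r_i) x_{i-1}, Q_i(r_i))`, for `i ≥ 1` -/
  F : ℕ → Fin K → Matrix (Fin m) (Fin m) ℝ
  Q : ℕ → Fin K → Matrix (Fin m) (Fin m) ℝ
  /-- `y_i` given `x_i, r_i` is `𝒩(H_i(r_i) x_i, R_i(r_i))`, for `i ≥ 0` -/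
  H : ℕ → Fin K → Matrix (Fin p) (Fin m) ℝ
  R : ℕ → Fin K → Matrix (Fin p) (Fin p) ℝ
  P0_posDef : ∀ r, (P0 r).PosDef
  Q_posDef : ∀ i r, (Q i r).PosDef
  R_posDef : ∀ i r, (R i r).PosDef

/-- A value of the pair `z = (x, y)`. -/
abbrev Obs (m p : ℕ) : Type := Vec m × Vec p

/-- A value of `(z, r)`. -/
abbrev State (K m p : ℕ) : Type := Obs m p × Fin K

namespace JMSS

variable {K m p : ℕ} (M : JMSS K m p)

/-- The law of the regime `r_i`. -/
def regimeLaw : ℕ → PMF (Fin K)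
  | 0 => M.initRegime
  | i + 1 => (regimeLaw i).bind (M.trans i)

/-- The pdf `f_{i|i-1}(x_i | x_{i-1}, r_i)`, as a kernel. -/
def f (i : ℕ) : Kernel (Vec m × Fin K) (Vec m) := gaussKernel (M.F i) (M.Q i)

/-- The pdf `g_i(y_i | x_i, r_i)`, as a kernel. -/
def g (i : ℕ) : Kernel (Vec m × Fin K) (Vec p) := gaussKernel (M.H i) (M.R i)

instance (i : ℕ) : IsMarkovKernel (M.f i) := by unfold f; infer_instance

instance (i : ℕ) : IsMarkovKernel (M.g i) := by unfold g; infer_instance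

/-- The law of `z_0` given `r_0`: the density is `p¹(x_0 | r_0) g_0(y_0 | x_0, r_0)`. -/
def z0Kernel : Kernel (Fin K) (Obs m p) :=
  (Kernel.ofFunOfCountable fun r => multivariateGaussian (M.m0 r) (M.P0 r)) ⊗ₖ
    (M.g 0).comap Prod.swap measurable_swap

instance : IsMarkovKernel M.z0Kernel := by
  have : IsMarkovKernel (Kernel.ofFunOfCountable fun r : Fin K =>
      multivariateGaussian (M.m0 r) (M.P0 r)) :=
    ⟨fun _ => inferInstanceAs (IsProbabilityMeasure (multivariateGaussian _ _))⟩
  unfold z0Kernel; infer_instance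

/-- The law of `(z_0, r_0)`. -/
def initLaw : Measure (State K m p) :=
  (M.initRegime.toMeasure ⊗ₘ M.z0Kernel).map Prod.swap

instance : IsProbabilityMeasure M.initLaw :=
  Measure.isProbabilityMeasure_map measurable_swap.aemeasurable

/-- The transition of `(z, r)` from time `i` to time `i + 1`: first `r_{i+1}` is drawn given `r_i`,
then `z_{i+1}` is drawn from `κ` given `z_i` and `(r_i, r_{i+1})`. -/
def stepKernel (κ : Kernel (Obs m p × (Fin K × Fin K)) (Obs m p)) (i : ℕ) :
    Kernel (State K m p) (State K m p) :=
  ((regimeKernel (M.trans i)).comap Prod.snd measurable_snd ⊗ₖ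
    κ.comap (fun u : State K m p × Fin K => (u.1.1, (u.1.2, u.2))) (by fun_prop)).map Prod.swap

instance (κ : Kernel (Obs m p × (Fin K × Fin K)) (Obs m p)) [IsMarkovKernel κ] (i : ℕ) :
    IsMarkovKernel (M.stepKernel κ i) :=
  Kernel.IsMarkovKernel.map _ measurable_swap

/-- The transition `p¹(z_{i+1} | z_i, r_i, r_{i+1})` of the jump Markov system; its density is
`f_{i+1|i}(x_{i+1} | x_i, r_{i+1}) g_{i+1}(y_{i+1} | x_{i+1}, r_{i+1})`. -/
def jmssKernel (i : ℕ) : Kernel (Obs m p × (Fin K × Fin K)) (Obs m p) :=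
  (M.f (i + 1)).comap (fun u => (u.1.1, u.2.2)) (by fun_prop) ⊗ₖ
    (M.g (i + 1)).comap (fun w => (w.2, w.1.2.2)) (by fun_prop)

instance (i : ℕ) : IsMarkovKernel (M.jmssKernel i) := by unfold jmssKernel; infer_instance

/-- The law `p¹` of `(z_{0:k}, r_{0:k})` in the jump Markov system. -/
def jmssLaw (k : ℕ) : Measure (Fin (k + 1) → State K m p) :=
  pathLaw M.initLaw (fun i => M.stepKernel (M.jmssKernel i) i) k

end JMSS

/-! ### Conditional pairwise Markov chains with the same physical properties -/

/-- A choice of the matrices `F²_{i+1}(r_i, r_{i+1})`, written `F2 i r_i r_{i+1}`. -/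
abbrev F2Param (K m p : ℕ) : Type := ℕ → Fin K → Fin K → Matrix (Fin m) (Fin p) ℝ

/-- A choice of the matrices `H²_{i+1}(r_i, r_{i+1})`, written `H2 i r_i r_{i+1}`. -/
abbrev H2Param (K p : ℕ) : Type := ℕ → Fin K → Fin K → Matrix (Fin p) (Fin p) ℝ

namespace JMSS

variable {K m p : ℕ} (M : JMSS K m p)

/-- The matrix `B_{i+1}(r, s)` of the mean of `z_{i+1}` given `z_i`, `r_i = r`, `r_{i+1} = s`. -/
def matB (F2 : F2Param K m p) (H2 : H2Param K p) (i : ℕ) (r s : Fin K) :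
    Matrix (Fin m ⊕ Fin p) (Fin m ⊕ Fin p) ℝ :=
  Matrix.fromBlocks
    (M.F (i + 1) s - F2 i r s * M.H i r) (F2 i r s)
    (M.H (i + 1) s * M.F (i + 1) s - H2 i r s * M.H i r) (H2 i r s)

/-- `Σ¹¹_{i+1}(r, s)` -/
def sigma11 (F2 : F2Param K m p) (i : ℕ) (r s : Fin K) : Matrix (Fin m) (Fin m) ℝ :=
  M.Q (i + 1) s - F2 i r s * M.R i r * (F2 i r s)ᵀ

/-- `Σ²¹_{i+1}(r, s)` -/
def sigma21 (F2 : F2Param K m p) (H2 : H2Param K p) (i : ℕ) (r s : Fin K) :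
    Matrix (Fin p) (Fin m) ℝ :=
  M.H (i + 1) s * M.Q (i + 1) s - H2 i r s * M.R i r * (F2 i r s)ᵀ

/-- `Σ²²_{i+1}(r, s)` -/
def sigma22 (H2 : H2Param K p) (i : ℕ) (r s : Fin K) : Matrix (Fin p) (Fin p) ℝ :=
  M.R (i + 1) s - H2 i r s * M.R i r * (H2 i r s)ᵀ
    + M.H (i + 1) s * M.Q (i + 1) s * (M.H (i + 1) s)ᵀ

/-- The covariance matrix `Σ_{i+1}(r, s)` of `z_{i+1}` given `z_i`, `r_i = r`, `r_{i+1} = s`. -/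
def matSigma (F2 : F2Param K m p) (H2 : H2Param K p) (i : ℕ) (r s : Fin K) :
    Matrix (Fin m ⊕ Fin p) (Fin m ⊕ Fin p) ℝ :=
  Matrix.fromBlocks
    (M.sigma11 F2 i r s) (M.sigma21 F2 H2 i r s)ᵀ
    (M.sigma21 F2 H2 i r s) (M.sigma22 H2 i r s)

/-- The parameters for which every `Σ_{i+1}(r, s)` is a positive definite covariance matrix. -/
def IsAdmissible (F2 : F2Param K m p) (H2 : H2Param K p) : Prop :=
  ∀ i r s, (M.matSigma F2 H2 i r s).PosDef

/-- The constraint `H_{i+1}(s) F_{i+1}(s) - H²_{i+1}(r, s) H_i(r) = 0`. -/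
def H2Constraint (H2 : H2Param K p) : Prop :=
  ∀ i r s, M.H (i + 1) s * M.F (i + 1) s - H2 i r s * M.H i r = 0

/-- The parameters of the models `p^{2,θ}` that satisfy the constraint on `H²`. -/
def constrainedClass : Set (F2Param K m p × H2Param K p) :=
  {θ | M.IsAdmissible θ.1 θ.2 ∧ M.H2Constraint θ.2}

/-- Stack `x` and `y` into one column vector. -/
def stack (z : Obs m p) : EuclideanSpace ℝ (Fin m ⊕ Fin p) :=
  WithLp.toLp 2 (Sum.elim (WithLp.ofLp z.1) (WithLp.ofLp z.2))

/-- Cut a column vector into `x` and `y`. -/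
def unstack (v : EuclideanSpace ℝ (Fin m ⊕ Fin p)) : Obs m p :=
  (WithLp.toLp 2 fun a => v (Sum.inl a), WithLp.toLp 2 fun b => v (Sum.inr b))

lemma measurable_stack : Measurable (stack : Obs m p → _) := by
  have h : Measurable fun z : Obs m p =>
      (Sum.elim (WithLp.ofLp z.1) (WithLp.ofLp z.2) : Fin m ⊕ Fin p → ℝ) := by
    refine measurable_pi_lambda _ fun a => ?_
    rcases a with a | b
    · simp only [Sum.elim_inl]; fun_prop
    · simp only [Sum.elim_inr]; fun_prop
  exact (WithLp.measurable_toLp 2 _).comp h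

lemma measurable_unstack : Measurable (unstack : _ → Obs m p) := by
  unfold unstack; fun_prop

/-- The transition `p^{2,θ}(z_{i+1} | z_i, r_i, r_{i+1}) = 𝒩(z_{i+1}; B z_i; Σ)`. -/
def pmcKernel (F2 : F2Param K m p) (H2 : H2Param K p) (i : ℕ) :
    Kernel (Obs m p × (Fin K × Fin K)) (Obs m p) :=
  ((gaussKernel (fun c : Fin K × Fin K => M.matB F2 H2 i c.1 c.2)
      (fun c => M.matSigma F2 H2 i c.1 c.2)).comap
    (fun u : Obs m p × (Fin K × Fin K) => (stack u.1, u.2))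
    (by exact (measurable_stack.comp measurable_fst).prodMk measurable_snd)).map unstack

instance (F2 : F2Param K m p) (H2 : H2Param K p) (i : ℕ) : IsMarkovKernel (M.pmcKernel F2 H2 i) :=
  Kernel.IsMarkovKernel.map _ measurable_unstack

/-- The law `p^{2,θ}` of `(z_{0:k}, r_{0:k})`, for `θ = (F², H²)`. -/
def pmcLaw (F2 : F2Param K m p) (H2 : H2Param K p) (k : ℕ) :
    Measure (Fin (k + 1) → State K m p) :=
  pathLaw M.initLaw (fun i => M.stepKernel (M.pmcKernel F2 H2 i) i) k

/-- The Kullback-Leibler divergence between `p^{2,θ}(z_{0:k}, r_{0:k})` and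
`p¹(z_{0:k}, r_{0:k})`. -/
def kld (k : ℕ) (F2 : F2Param K m p) (H2 : H2Param K p) : ℝ≥0∞ :=
  klDiv (M.pmcLaw F2 H2 k) (M.jmssLaw k)

/-- `Q_{i+1}(s) H_{i+1}(s)ᵀ [R_{i+1}(s) + H_{i+1}(s) Q_{i+1}(s) H_{i+1}(s)ᵀ]⁻¹ H²_{i+1}(r, s)` -/
def optF2 (H2 : H2Param K p) : F2Param K m p := fun i r s =>
  M.Q (i + 1) s * (M.H (i + 1) s)ᵀ *
    (M.R (i + 1) s + M.H (i + 1) s * M.Q (i + 1) s * (M.H (i + 1) s)ᵀ)⁻¹ * H2 i r s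

/-- `F2` agrees with `F2'` up to time `k`, for all pairs of regimes `(r_i, r_{i+1})` that
occur with positive probability. -/
def AgreeUpTo (k : ℕ) (F2 F2' : F2Param K m p) : Prop :=
  ∀ i < k, ∀ r s, M.regimeLaw i r ≠ 0 → M.trans i r s ≠ 0 → F2 i r s = F2' i r s

end JMSS

end JumpPMC

end

/-! The chain rule for the Kullback-Leibler divergence reduces the problem to single transitions,
since both models share the initial law and the regime transitions. For one transition the
log-likelihood ratio of two Gaussians is half the log ratio of the determinants plus half the
difference of two Mahalanobis forms. The form built from the pairwise chain has mean `m + p`, the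
dimension.

The form built from the jump system also has mean `m + p`, although the expectation is taken under
the pairwise chain. Indeed `B` and `Σ` are arranged so that averaging the transition over `y_i ∼
g_i(· | x_i, r_i)` gives exactly the transition of the jump system (`lintegral_g_pmcKernel`). By
induction, `y_i` given `(x_i, r_i)` does have law `g_i` in the pairwise chain
(`lintegral_redraw_pmcLaw`). The quadratic terms therefore cancel, and the divergence is a finite
sum of the `logDetGap`s, weighted by regime probabilities that do not depend on the parameters
(`kld_eq_sum`).

Minimizing over `F²` thus means maximizing each `det Σ` of positive weight. The block `Σ²²` does not
involve `F²`, so only its Schur complement matters. Completing the square (`schurSigma_add`) shows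
that this complement is a fixed matrix minus `D N Dᵀ`, where `N` is positive definite and `D` is the
deviation of `F²` from the optimum. Strict monotonicity of the determinant (`det_le_det_add`) makes
`D = 0` the only maximizer. A joint minimizer is in particular a minimizer for its own `H²`, which
gives the second claim. -/

noncomputable section

namespace JumpPMC

/-! ### Linear images and sums of Gaussian measures -/

section

variable {ι κ : Type} [Fintype ι] [Fintype κ]

lemma measurable_toLp_mulVec (C : Matrix ι κ ℝ) :
    Measurable fun y : EuclideanSpace ℝ κ =>
      (WithLp.toLp 2 (C *ᵥ WithLp.ofLp y) : EuclideanSpace ℝ ι) := by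
  have h : Continuous fun v : κ → ℝ => C *ᵥ v := by fun_prop
  exact (WithLp.measurable_toLp 2 (ι → ℝ)).comp (h.measurable.comp (WithLp.measurable_ofLp 2 _))

variable [DecidableEq ι] [DecidableEq κ]

/-- Characteristic functions, rather than densities, because `C` may be tall and `C * T * Cᵀ` is
then singular. -/
lemma multivariateGaussian_map_mulVec {a : EuclideanSpace ℝ κ} {T : Matrix κ κ ℝ}
    (hT : T.PosSemidef) (C : Matrix ι κ ℝ) :
    (multivariateGaussian a T).map (fun y => WithLp.toLp 2 (C *ᵥ WithLp.ofLp y)) =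
      multivariateGaussian (WithLp.toLp 2 (C *ᵥ WithLp.ofLp a)) (C * T * Cᵀ) := by
  have hinner (y : EuclideanSpace ℝ κ) (t : EuclideanSpace ℝ ι) :
      inner ℝ (WithLp.toLp 2 (C *ᵥ WithLp.ofLp y)) t =
        inner ℝ y (WithLp.toLp 2 (Cᵀ *ᵥ WithLp.ofLp t)) := by
    simp only [EuclideanSpace.inner_eq_star_dotProduct, star_trivial, Matrix.mulVec_transpose]
    rw [Matrix.dotProduct_mulVec]
  have hT' : (C * T * Cᵀ).PosSemidef := by
    simpa using hT.mul_mul_conjTranspose_same C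
  have := measurable_toLp_mulVec C
  have : IsProbabilityMeasure ((multivariateGaussian a T).map
      (fun y => (WithLp.toLp 2 (C *ᵥ WithLp.ofLp y) : EuclideanSpace ℝ ι))) :=
    Measure.isProbabilityMeasure_map this.aemeasurable
  refine Measure.ext_of_charFun ?_
  ext t
  rw [charFun_apply, integral_map (by fun_prop) (by fun_prop)]
  simp_rw [hinner]
  rw [← charFun_apply, charFun_multivariateGaussian hT, charFun_multivariateGaussian hT',
    real_inner_comm, ← hinner, real_inner_comm]
  congr 3
  simp only [Matrix.mulVec_transpose, ← Matrix.mulVec_mulVec,  Matrix.dotProduct_mulVec]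

lemma multivariateGaussian_conv (a b : EuclideanSpace ℝ ι) {S T : Matrix ι ι ℝ}
    (hS : S.PosSemidef) (hT : T.PosSemidef) :
    multivariateGaussian a S ∗ multivariateGaussian b T = multivariateGaussian (a + b) (S + T) := by
  refine Measure.ext_of_charFun ?_
  ext t
  rw [charFun_conv, charFun_multivariateGaussian hS, charFun_multivariateGaussian hT,
    charFun_multivariateGaussian (hS.add hT), ← Complex.exp_add, inner_add_right,
    Matrix.add_mulVec, dotProduct_add]
  push_cast
  ring_nf

lemma multivariateGaussian_add_left (u c : EuclideanSpace ℝ ι) (S : Matrix ι ι ℝ) :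
    multivariateGaussian (u + c) S = (multivariateGaussian c S).map (u + ·) := by
  rw [multivariateGaussian, multivariateGaussian, Measure.map_map (by fun_prop) (by fun_prop)]
  congr 1
  ext x : 1
  simp [add_assoc]

/-- Law of `C y + D w` for independent Gaussians. It serves twice: for drawing `x'` and then the
observation noise, and for drawing `y_i` and then the pairwise transition. -/
lemma lintegral_multivariateGaussian_mulVec_add {J : Type} [Fintype J] [DecidableEq J]
    {a : EuclideanSpace ℝ κ} {b : EuclideanSpace ℝ J} {T : Matrix κ κ ℝ} {S : Matrix J J ℝ}
    (hT : T.PosSemidef) (hS : S.PosSemidef) (C : Matrix ι κ ℝ) (D : Matrix ι J ℝ)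
    {h : EuclideanSpace ℝ ι → ℝ≥0∞} (hh : Measurable h) :
    ∫⁻ y, ∫⁻ w, h (WithLp.toLp 2 (C *ᵥ WithLp.ofLp y) + WithLp.toLp 2 (D *ᵥ WithLp.ofLp w))
        ∂(multivariateGaussian b S) ∂(multivariateGaussian a T) =
      ∫⁻ v, h v ∂(multivariateGaussian
        (WithLp.toLp 2 (C *ᵥ WithLp.ofLp a) + WithLp.toLp 2 (D *ᵥ WithLp.ofLp b))
        (C * T * Cᵀ + D * S * Dᵀ)) := by
  have hC := measurable_toLp_mulVec C
  have hD := measurable_toLp_mulVec D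
  rw [← multivariateGaussian_conv _ _ (by simpa using hT.mul_mul_conjTranspose_same C)
    (by simpa using hS.mul_mul_conjTranspose_same D), ← multivariateGaussian_map_mulVec hT,
    ← multivariateGaussian_map_mulVec hS, Measure.lintegral_conv hh, lintegral_map _ hC]
  · refine lintegral_congr fun y => ?_
    rw [lintegral_map (by fun_prop) hD]
  · fun_prop

end

/-! ### Gaussian densities and the mean of the Mahalanobis form -/

section

variable {ι : Type} [Fintype ι] [DecidableEq ι]

/-- Normalizing constant of the standard Gaussian density. -/
def stdNormalizer (ι : Type) [Fintype ι] : ℝ :=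
  (∫ v : EuclideanSpace ℝ ι, Real.exp (-(1 / 2) * ‖v‖ ^ 2))⁻¹

lemma stdNormalizer_pos (ι : Type) [Fintype ι] : 0 < stdNormalizer ι := by
  unfold stdNormalizer
  rw [GaussianFourier.integral_rexp_neg_mul_sq_norm (by norm_num)]
  positivity

lemma stdGaussian_eq_withDensity (ι : Type) [Fintype ι] :
    stdGaussian (EuclideanSpace ℝ ι) = volume.withDensity fun v =>
      ENNReal.ofReal (stdNormalizer ι * Real.exp (-(1 / 2) * ‖v‖ ^ 2)) := by
  have hb : (0 : ℝ) < ((1 / 2 : ℂ)).re := by norm_num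
  have hint : Integrable fun v : EuclideanSpace ℝ ι => Real.exp (-(1 / 2) * ‖v‖ ^ 2) := by
    -- A non-integrable function has Bochner integral `0`, which would make the normalizer zero.
    by_contra h
    have h1 := stdNormalizer_pos ι
    rw [stdNormalizer, integral_undef h] at h1
    simp at h1
  have : IsFiniteMeasure (volume.withDensity fun v : EuclideanSpace ℝ ι =>
      ENNReal.ofReal (stdNormalizer ι * Real.exp (-(1 / 2) * ‖v‖ ^ 2))) :=
    isFiniteMeasure_withDensity_ofReal (hint.const_mul _).2
  -- The constant of the Fourier formula is the complex form of the integral defining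
  -- `stdNormalizer`.
  have hc : (stdNormalizer ι : ℂ) *
      (Real.pi / (1 / 2 : ℂ)) ^ (Module.finrank ℝ (EuclideanSpace ℝ ι) / 2 : ℂ) = 1 := by
    rw [← GaussianFourier.integral_cexp_neg_mul_sq_norm hb]
    have h2 : ∫ v : EuclideanSpace ℝ ι, Complex.exp (-(1 / 2) * ‖v‖ ^ 2) =
        ((∫ v : EuclideanSpace ℝ ι, Real.exp (-(1 / 2) * ‖v‖ ^ 2) : ℝ) : ℂ) := by
      rw [← integral_complex_ofReal]
      push_cast
      rfl
    rw [h2, stdNormalizer, ← Complex.ofReal_mul, inv_mul_cancel₀, Complex.ofReal_one]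
    have h1 := stdNormalizer_pos ι
    rw [stdNormalizer] at h1
    exact (inv_pos.1 h1).ne'
  refine Measure.ext_of_charFun ?_
  ext t
  rw [charFun_stdGaussian, charFun_apply, integral_withDensity_eq_integral_toReal_smul
    (by fun_prop) (ae_of_all _ fun _ => ENNReal.ofReal_lt_top)]
  have (v : EuclideanSpace ℝ ι) :
      (ENNReal.ofReal (stdNormalizer ι * Real.exp (-(1 / 2) * ‖v‖ ^ 2))).toReal •
        Complex.exp (inner ℝ v t * Complex.I) =
      (stdNormalizer ι : ℂ) *
        Complex.exp (-(1 / 2 : ℂ) * ‖v‖ ^ 2 + Complex.I * (inner ℝ t v : ℝ)) := by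
    rw [ENNReal.toReal_ofReal (mul_nonneg (stdNormalizer_pos ι).le (Real.exp_nonneg _)),
      Complex.exp_add, Complex.real_smul, real_inner_comm]
    push_cast
    ring_nf
  simp_rw [this]
  rw [integral_const_mul, GaussianFourier.integral_cexp_neg_mul_sq_norm_add hb, ← mul_assoc, hc,
    one_mul]
  congr 1
  rw [Complex.I_sq]
  ring

/-- The quadratic form `v ↦ vᵀ S⁻¹ v`. -/
def invQuad (S : Matrix ι ι ℝ) (v : EuclideanSpace ℝ ι) : ℝ :=
  WithLp.ofLp v ⬝ᵥ S⁻¹ *ᵥ WithLp.ofLp v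

@[fun_prop]
lemma continuous_invQuad (S : Matrix ι ι ℝ) : Continuous (invQuad S) := by
  unfold invQuad
  fun_prop

lemma invQuad_nonneg {S : Matrix ι ι ℝ} (hS : S.PosDef) (v : EuclideanSpace ℝ ι) :
    0 ≤ invQuad S v := by
  have h := hS.inv.posSemidef.dotProduct_mulVec_nonneg (WithLp.ofLp v)
  rwa [star_trivial] at h

section sqrt
open scoped MatrixOrder

lemma invQuad_sqrt {S : Matrix ι ι ℝ} (hS : S.PosDef) (v : EuclideanSpace ℝ ι) :
    invQuad S (Matrix.toEuclideanCLM (𝕜 := ℝ) (CFC.sqrt S) v) = ‖v‖ ^ 2 := by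
  have h1 : CFC.sqrt S * CFC.sqrt S = S := CFC.sqrt_mul_sqrt_self _ hS.posSemidef.nonneg
  have h2 : (CFC.sqrt S)ᵀ = CFC.sqrt S := by
    have := (CFC.sqrt_nonneg S).isSelfAdjoint
    simpa [IsSelfAdjoint, Matrix.star_eq_conjTranspose] using this
  have hu : IsUnit S.det := hS.det_pos.ne'.isUnit
  have hu' : IsUnit (CFC.sqrt S).det := by
    rw [← h1, Matrix.det_mul] at hu
    exact isUnit_of_mul_isUnit_left hu
  have h3 : CFC.sqrt S * S⁻¹ * CFC.sqrt S = 1 := by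
    have : S⁻¹ = (CFC.sqrt S)⁻¹ * (CFC.sqrt S)⁻¹ := by
      rw [← Matrix.mul_inv_rev, h1]
    rw [this, Matrix.mul_nonsing_inv_cancel_left _ _ hu', Matrix.nonsing_inv_mul _ hu']
  rw [invQuad, Matrix.ofLp_toEuclideanCLM, EuclideanSpace.real_norm_sq_eq]
  have : (CFC.sqrt S *ᵥ WithLp.ofLp v) ⬝ᵥ S⁻¹ *ᵥ (CFC.sqrt S *ᵥ WithLp.ofLp v) =
      WithLp.ofLp v ⬝ᵥ (CFC.sqrt S * S⁻¹ * CFC.sqrt S) *ᵥ WithLp.ofLp v := by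
    nth_rw 1 [← h2]
    rw [Matrix.mulVec_transpose, ← Matrix.dotProduct_mulVec, Matrix.mulVec_mulVec,
      Matrix.mulVec_mulVec, mul_assoc]
  rw [this, h3, Matrix.one_mulVec]
  simp [dotProduct, sq]

/-- Change of variables along `v ↦ a + S^{1/2} v`, whose Jacobian is `√S.det` and which turns
`invQuad S` into the squared norm. -/
lemma multivariateGaussian_eq_withDensity (a : EuclideanSpace ℝ ι) {S : Matrix ι ι ℝ}
    (hS : S.PosDef) :
    multivariateGaussian a S = volume.withDensity fun v =>
      ENNReal.ofReal (stdNormalizer ι * (√S.det)⁻¹ * Real.exp (-(1 / 2) * invQuad S (v - a))) := by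
  set L := Matrix.toEuclideanCLM (n := ι) (𝕜 := ℝ) (CFC.sqrt S)
  have hdet : LinearMap.det (L : EuclideanSpace ℝ ι →ₗ[ℝ] EuclideanSpace ℝ ι) = √S.det := by
    have : LinearMap.det (L : EuclideanSpace ℝ ι →ₗ[ℝ] EuclideanSpace ℝ ι) = (CFC.sqrt S).det := by
      rw [Matrix.coe_toEuclideanCLM_eq_toEuclideanLin, Matrix.toEuclideanLin_eq_toLin_orthonormal,
        LinearMap.det_toLin]
    rw [this, hS.posSemidef.det_sqrt]
    simp [RCLike.sqrt_of_nonneg hS.det_pos.le]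
  have hpos : 0 < √S.det := Real.sqrt_pos.2 hS.det_pos
  have hvol : (volume : Measure (EuclideanSpace ℝ ι)).map (fun x => a + L x) =
      ENNReal.ofReal (√S.det)⁻¹ • volume := by
    have h1 : (fun x => a + L x) = (a + ·) ∘ ⇑(L : EuclideanSpace ℝ ι →ₗ[ℝ] EuclideanSpace ℝ ι) := rfl
    rw [h1, ← Measure.map_map (by fun_prop) (by exact L.continuous.measurable),
      Measure.map_linearMap_addHaar_eq_smul_addHaar _ (by rw [hdet]; exact hpos.ne'), hdet,
      abs_of_pos (inv_pos.2 hpos), Measure.map_smul, map_add_left_eq_self]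
  refine Measure.ext_of_lintegral _ fun h hh => ?_
  rw [multivariateGaussian, lintegral_map hh (by fun_prop), stdGaussian_eq_withDensity,
    lintegral_withDensity_eq_lintegral_mul _ (by fun_prop) (by fun_prop),
    lintegral_withDensity_eq_lintegral_mul _ (by fun_prop) hh]
  have hG : Measurable fun w => ENNReal.ofReal
      (stdNormalizer ι * Real.exp (-(1 / 2) * invQuad S (w - a))) * h w := by fun_prop
  have key (v : EuclideanSpace ℝ ι) :
      ENNReal.ofReal (stdNormalizer ι * Real.exp (-(1 / 2) * ‖v‖ ^ 2)) * h (a + L v) =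
        (fun w => ENNReal.ofReal
          (stdNormalizer ι * Real.exp (-(1 / 2) * invQuad S (w - a))) * h w) (a + L v) := by
    simp only [add_sub_cancel_left, L, invQuad_sqrt hS]
  simp only [Pi.mul_apply]
  rw [lintegral_congr key, ← lintegral_map hG (by fun_prop), hvol, lintegral_smul_measure,
    smul_eq_mul, ← lintegral_const_mul _ hG]
  refine lintegral_congr fun v => ?_
  rw [← mul_assoc, ← ENNReal.ofReal_mul (by positivity)]
  ring_nf

/-- After whitening, this is a sum of unit variances. The value does not depend on `S`, which is
what lets the quadratic terms of two different covariances cancel. -/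
lemma lintegral_invQuad (a : EuclideanSpace ℝ ι) {S : Matrix ι ι ℝ} (hS : S.PosDef) :
    ∫⁻ v, ENNReal.ofReal (invQuad S (v - a)) ∂(multivariateGaussian a S) = Fintype.card ι := by
  rw [multivariateGaussian, lintegral_map (by fun_prop) (by fun_prop)]
  simp only [add_sub_cancel_left, invQuad_sqrt hS]
  have hint (i : ι) : Integrable (fun x : EuclideanSpace ℝ ι => x i ^ 2)
      (stdGaussian (EuclideanSpace ℝ ι)) := by
    have h := (IsGaussian.memLp_two_id (μ := stdGaussian (EuclideanSpace ℝ ι)))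
    exact (MemLp.integrable_sq ((EuclideanSpace.proj (𝕜 := ℝ) i).comp_memLp' h))
  have hval (i : ι) : ∫ x : EuclideanSpace ℝ ι, x i ^ 2 ∂(stdGaussian (EuclideanSpace ℝ ι)) = 1 := by
    have h := variance_eval_multivariateGaussian (μ := 0) (Matrix.PosSemidef.one (n := ι) (R := ℝ)) i
    rw [multivariateGaussian_zero_one, variance_of_integral_eq_zero (by fun_prop)] at h
    · simpa using h
    · exact integral_strongDual_stdGaussian (EuclideanSpace.proj (𝕜 := ℝ) i)
  simp_rw [EuclideanSpace.real_norm_sq_eq]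
  rw [← ofReal_integral_eq_lintegral_ofReal (integrable_finsetSum _ fun i _ => hint i)
    (ae_of_all _ fun x => by positivity), integral_finsetSum _ fun i _ => hint i]
  simp [hval]

end sqrt

end

/-! ### Determinant monotonicity and Schur complements -/

section determinants
open Matrix
variable {ι κ : Type} [Fintype ι] [DecidableEq ι] [Fintype κ] [DecidableEq κ]

omit [DecidableEq ι] [DecidableEq κ] in
lemma posSemidef_mul_mul_transpose {A : Matrix ι ι ℝ} (hA : A.PosSemidef) (B : Matrix κ ι ℝ) :
    (B * A * Bᵀ).PosSemidef := by
  simpa only [conjTranspose_eq_transpose_of_trivial] using hA.mul_mul_conjTranspose_same B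

omit [DecidableEq ι] in
lemma eq_zero_of_mul_mul_transpose_eq_zero {N : Matrix ι ι ℝ} (hN : N.PosDef) {B : Matrix κ ι ℝ}
    (h : B * N * Bᵀ = 0) : B = 0 := by
  have hx (x : κ → ℝ) : Bᵀ *ᵥ x = 0 := by
    by_contra hne
    have h1 := hN.dotProduct_mulVec_pos hne
    rw [star_trivial, mulVec_transpose, ← dotProduct_mulVec, mulVec_mulVec,
      ← mulVec_transpose, mulVec_mulVec, h, zero_mulVec, dotProduct_zero] at h1
    exact lt_irrefl _ h1
  have : Bᵀ = 0 := by
    ext i j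
    have := congrFun (hx (Pi.single j 1)) i
    simpa using this
  simpa using congrArg transpose this

omit [Fintype ι] in
lemma one_add_sum_le_prod_one_add (s : Finset ι) {f : ι → ℝ} (hf : ∀ i, 0 ≤ f i) :
    1 + ∑ i ∈ s, f i ≤ ∏ i ∈ s, (1 + f i) := by
  induction s using Finset.induction_on with
  | empty => simp
  | insert a s ha ih =>
    rw [Finset.sum_insert ha, Finset.prod_insert ha]
    nlinarith [hf a, mul_le_mul_of_nonneg_left ih (hf a),
      mul_nonneg (hf a) (Finset.sum_nonneg fun i (_ : i ∈ s) => hf i)]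

/-- In terms of the eigenvalues, `∏ (1 + λ) ≥ 1 + ∑ λ`; the product is read off the characteristic
polynomial at `-1`. -/
lemma one_add_trace_le_det_one_add {A : Matrix ι ι ℝ} (hA : A.PosSemidef) :
    1 + A.trace ≤ (1 + A).det := by
  have h1 : (1 + A).det = ∏ i, (1 + hA.isHermitian.eigenvalues i) := by
    have h2 := Matrix.eval_charpoly A (-1)
    rw [hA.isHermitian.charpoly_eq, Polynomial.eval_prod] at h2
    have h3 : Matrix.scalar ι (-1 : ℝ) - A = -(1 + A) := by
      simp only [map_neg, map_one]
      abel
    rw [h3, Matrix.det_neg] at h2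
    have h4 : ∏ i, (1 + hA.isHermitian.eigenvalues i) =
        (-1) ^ Fintype.card ι *
          ∏ i, (Polynomial.X - Polynomial.C (hA.isHermitian.eigenvalues i)).eval (-1 : ℝ) := by
      rw [← Finset.card_univ, ← Finset.prod_const, ← Finset.prod_mul_distrib]
      refine Finset.prod_congr rfl fun i _ => ?_
      simp
      ring
    simp only [RCLike.ofReal_real_eq_id, id_eq] at h2
    rw [h4, h2, ← mul_assoc, ← mul_pow]
    simp
  rw [h1, hA.isHermitian.trace_eq_sum_eigenvalues]
  simpa using one_add_sum_le_prod_one_add Finset.univ hA.eigenvalues_nonneg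

open scoped MatrixOrder in
-- With `P = Bᵀ B`, the ratio of the determinants is `det (1 + B A⁻¹ Bᵀ) ≥ 1 + tr (B A⁻¹ Bᵀ)`. A
-- ratio at most `1` kills the trace, hence `B`.
lemma det_le_det_add {A P : Matrix ι ι ℝ} (hA : A.PosDef) (hP : P.PosSemidef) :
    A.det ≤ (A + P).det ∧ ((A + P).det ≤ A.det → P = 0) := by
  obtain ⟨B, rfl⟩ : ∃ B : Matrix ι ι ℝ, P = Bᵀ * B := by
    obtain ⟨B, hB⟩ := CStarAlgebra.nonneg_iff_eq_star_mul_self.1 hP.nonneg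
    exact ⟨B, by rw [hB, star_eq_conjTranspose, conjTranspose_eq_transpose_of_trivial]⟩
  rw [Matrix.det_add_mul _ _ hA.det_pos.ne'.isUnit]
  have hM : (B * A⁻¹ * Bᵀ).PosSemidef := posSemidef_mul_mul_transpose hA.inv.posSemidef B
  have h1 := one_add_trace_le_det_one_add hM
  have h2 := hM.trace_nonneg
  refine ⟨le_mul_of_one_le_right hA.det_pos.le (by linarith), fun h => ?_⟩
  have h3 : (1 + B * A⁻¹ * Bᵀ).det ≤ 1 := by
    by_contra h4
    exact absurd h (not_le.2 (lt_mul_of_one_lt_right hA.det_pos (not_le.1 h4)))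
  have h5 : B * A⁻¹ * Bᵀ = 0 := hM.trace_eq_zero_iff.1 (by linarith)
  rw [eq_zero_of_mul_mul_transpose_eq_zero hA.inv h5]
  simp

lemma det_fromBlocks_transpose (A : Matrix ι ι ℝ) (C : Matrix κ ι ℝ) {D : Matrix κ κ ℝ}
    (hD : D.PosDef) :
    (fromBlocks A Cᵀ C D).det = D.det * (A - Cᵀ * D⁻¹ * C).det := by
  have := hD.isUnit.invertible
  rw [Matrix.det_fromBlocks₂₂, invOf_eq_nonsing_inv]

/-- The semidefinite Schur criterion becomes definite because the determinant factors. -/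
lemma posDef_fromBlocks_transpose_iff (A : Matrix ι ι ℝ) (C : Matrix κ ι ℝ) {D : Matrix κ κ ℝ}
    (hD : D.PosDef) :
    (fromBlocks A Cᵀ C D).PosDef ↔ (A - Cᵀ * D⁻¹ * C).PosDef := by
  have := hD.isUnit.invertible
  have h := Matrix.PosDef.fromBlocks₂₂ A Cᵀ hD
  simp only [conjTranspose_eq_transpose_of_trivial, transpose_transpose] at h
  have hdet := det_fromBlocks_transpose A C hD
  constructor
  · intro hp
    refine (h.1 hp.posSemidef).posDef_iff_det_ne_zero.2 fun h0 => hp.det_pos.ne' ?_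
    rw [hdet, h0, mul_zero]
  · intro hp
    refine (h.2 hp.posSemidef).posDef_iff_det_ne_zero.2 ?_
    rw [hdet]
    exact (mul_pos hD.det_pos hp.det_pos).ne'

omit [Fintype ι] [DecidableEq ι] in
-- Completing the square in the gain `D + G * H`: the terms linear in `D` cancel. In the application
-- `W` is `Σ²²` and `H` is `H²`.
lemma schur_complement_identity (Q : Matrix ι ι ℝ) (G D : Matrix ι κ ℝ) {W R : Matrix κ κ ℝ}
    (H : Matrix κ κ ℝ) (hW : Wᵀ = W) (hR : Rᵀ = R) (hu : IsUnit W.det) :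
    Q - (D + G * H) * R * (D + G * H)ᵀ -
        (W * Gᵀ - H * R * Dᵀ)ᵀ * W⁻¹ * (W * Gᵀ - H * R * Dᵀ) +
        D * (R + R * Hᵀ * W⁻¹ * (R * Hᵀ)ᵀ) * Dᵀ =
      Q - G * (W + H * R * Hᵀ) * Gᵀ := by
  have hcan (X : Matrix κ ι ℝ) : W⁻¹ * (W * X) = X := nonsing_inv_mul_cancel_left _ _ hu
  have hcan' (X : Matrix κ ι ℝ) : W * (W⁻¹ * X) = X := mul_nonsing_inv_cancel_left _ _ hu
  simp only [transpose_add, transpose_sub, transpose_mul, transpose_transpose, hW, hR,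
    Matrix.add_mul, Matrix.mul_add, Matrix.sub_mul, Matrix.mul_sub, Matrix.mul_assoc, hcan, hcan']
  abel

end determinants

/-! ### Conditional covariances and the optimal gain -/

namespace JMSS
open Matrix
variable {K m p : ℕ} (M : JMSS K m p)

/-- Covariance matrix of `z_{i+1}` given `z_i` and the regimes, in the jump Markov system. -/
def jmssSigma (i : ℕ) (s : Fin K) : Matrix (Fin m ⊕ Fin p) (Fin m ⊕ Fin p) ℝ :=
  fromBlocks (M.Q (i + 1) s) (M.H (i + 1) s * M.Q (i + 1) s)ᵀ (M.H (i + 1) s * M.Q (i + 1) s)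
    (M.R (i + 1) s + M.H (i + 1) s * M.Q (i + 1) s * (M.H (i + 1) s)ᵀ)

/-- The column of matrices by which `y_i` acts on the mean of `z_{i+1}`. -/
def gainCol (F2 : F2Param K m p) (H2 : H2Param K p) (i : ℕ) (r s : Fin K) :
    Matrix (Fin m ⊕ Fin p) (Fin p) ℝ :=
  fromRows (F2 i r s) (H2 i r s)

lemma Q_transpose (i : ℕ) (s : Fin K) : (M.Q i s)ᵀ = M.Q i s := by
  simpa [IsHermitian] using (M.Q_posDef i s).isHermitian

lemma R_transpose (i : ℕ) (s : Fin K) : (M.R i s)ᵀ = M.R i s := by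
  simpa [IsHermitian] using (M.R_posDef i s).isHermitian

/-- Law of total covariance: the spread of the mean caused by `y_i`, plus `Σ`, is the covariance in
the jump system. This explains the shape of `Σ`. -/
lemma gainCol_mul_R_mul_add_matSigma (F2 : F2Param K m p) (H2 : H2Param K p) (i : ℕ)
    (r s : Fin K) :
    gainCol F2 H2 i r s * M.R i r * (gainCol F2 H2 i r s)ᵀ + M.matSigma F2 H2 i r s =
      M.jmssSigma i s := by
  rw [gainCol, transpose_fromRows, fromRows_mul, fromRows_mul_fromCols, matSigma, fromBlocks_add,
    jmssSigma, sigma11, sigma21, sigma22]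
  congr 1
  · abel
  · simp only [transpose_sub, transpose_mul, transpose_transpose, R_transpose, Matrix.mul_assoc]
    abel
  · abel
  · abel

lemma jmssSigma_eq (i : ℕ) (s : Fin K) : M.jmssSigma i s =
    fromRows 1 (M.H (i + 1) s) * M.Q (i + 1) s * (fromRows 1 (M.H (i + 1) s))ᵀ +
      fromRows (0 : Matrix (Fin m) (Fin p) ℝ) 1 * M.R (i + 1) s *
        (fromRows (0 : Matrix (Fin m) (Fin p) ℝ) 1)ᵀ := by
  rw [jmssSigma, fromRows_mul 1, fromRows_mul 0, transpose_fromRows, transpose_fromRows,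
    fromRows_mul_fromCols, fromRows_mul_fromCols, fromBlocks_add]
  simp [Q_transpose, add_comm]

lemma jmssSigma_posDef (i : ℕ) (s : Fin K) : (M.jmssSigma i s).PosDef := by
  have hS : (M.jmssSigma i s).PosSemidef := by
    rw [jmssSigma_eq]
    exact PosSemidef.add (posSemidef_mul_mul_transpose (M.Q_posDef _ _).posSemidef _)
      (posSemidef_mul_mul_transpose (M.R_posDef _ _).posSemidef _)
  refine hS.posDef_iff_det_ne_zero.2 ?_
  have := (M.Q_posDef (i + 1) s).isUnit.invertible
  rw [jmssSigma, det_fromBlocks₁₁, invOf_eq_nonsing_inv]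
  have h2 : M.R (i + 1) s + M.H (i + 1) s * M.Q (i + 1) s * (M.H (i + 1) s)ᵀ -
      M.H (i + 1) s * M.Q (i + 1) s * (M.Q (i + 1) s)⁻¹ * (M.H (i + 1) s * M.Q (i + 1) s)ᵀ =
        M.R (i + 1) s := by
    rw [mul_nonsing_inv_cancel_right _ _ (M.Q_posDef _ _).det_pos.ne'.isUnit, transpose_mul,
      Q_transpose, Matrix.mul_assoc, add_sub_cancel_right]
  rw [h2]
  exact (mul_pos (M.Q_posDef _ _).det_pos (M.R_posDef _ _).det_pos).ne'

lemma det_matSigma_le (F2 : F2Param K m p) (H2 : H2Param K p) (i : ℕ) (r s : Fin K)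
    (h : (M.matSigma F2 H2 i r s).PosDef) :
    (M.matSigma F2 H2 i r s).det ≤ (M.jmssSigma i s).det := by
  rw [← M.gainCol_mul_R_mul_add_matSigma F2 H2 i r s, add_comm]
  refine (det_le_det_add h ?_).1
  exact posSemidef_mul_mul_transpose (M.R_posDef i r).posSemidef _

/-- Covariance matrix of `y_{i+1}` given `x_i` in the jump Markov system. -/
def innovCov (i : ℕ) (s : Fin K) : Matrix (Fin p) (Fin p) ℝ :=
  M.R (i + 1) s + M.H (i + 1) s * M.Q (i + 1) s * (M.H (i + 1) s)ᵀ

lemma innovCov_posDef (i : ℕ) (s : Fin K) : (M.innovCov i s).PosDef := by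
  exact (M.R_posDef (i + 1) s).add_posSemidef
    (posSemidef_mul_mul_transpose (M.Q_posDef (i + 1) s).posSemidef (M.H (i + 1) s))

/-- The Schur complement of `Σ²²` in `Σ`. -/
def schurSigma (F2 : F2Param K m p) (H2 : H2Param K p) (i : ℕ) (r s : Fin K) :
    Matrix (Fin m) (Fin m) ℝ :=
  M.sigma11 F2 i r s - (M.sigma21 F2 H2 i r s)ᵀ * (M.sigma22 H2 i r s)⁻¹ * M.sigma21 F2 H2 i r s

/-- The weight of the squared deviation from the optimal gain in the Schur complement. -/
def gainWeight (H2 : H2Param K p) (i : ℕ) (r s : Fin K) : Matrix (Fin p) (Fin p) ℝ :=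
  M.R i r + M.R i r * (H2 i r s)ᵀ * (M.sigma22 H2 i r s)⁻¹ * (M.R i r * (H2 i r s)ᵀ)ᵀ

lemma sigma22_posDef {F2 : F2Param K m p} {H2 : H2Param K p} {i : ℕ} {r s : Fin K}
    (h : (M.matSigma F2 H2 i r s).PosDef) : (M.sigma22 H2 i r s).PosDef := by
  have h1 := h.submatrix (e := Sum.inr) Sum.inr_injective
  exact h1

lemma gainWeight_posDef {H2 : H2Param K p} {i : ℕ} {r s : Fin K}
    (h : (M.sigma22 H2 i r s).PosDef) : (M.gainWeight H2 i r s).PosDef := by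
  exact (M.R_posDef i r).add_posSemidef
    (posSemidef_mul_mul_transpose h.inv.posSemidef (M.R i r * (H2 i r s)ᵀ))

/-- The optimum is `G * H2` with `G * innovCov = Q Hᵀ`, so that `Σ²¹ = Σ²² Gᵀ - H² R Dᵀ` and the
square can be completed. -/
lemma schurSigma_add {F2 : F2Param K m p} {H2 : H2Param K p} {i : ℕ} {r s : Fin K}
    (h : (M.sigma22 H2 i r s).PosDef) :
    M.schurSigma F2 H2 i r s + (F2 i r s - M.optF2 H2 i r s) * M.gainWeight H2 i r s *
        (F2 i r s - M.optF2 H2 i r s)ᵀ =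
      M.schurSigma (M.optF2 H2) H2 i r s := by
  obtain ⟨G, hG⟩ : ∃ G, G = M.Q (i + 1) s * (M.H (i + 1) s)ᵀ * (M.innovCov i s)⁻¹ := ⟨_, rfl⟩
  have hWt : (M.sigma22 H2 i r s)ᵀ = M.sigma22 H2 i r s := by
    simpa [IsHermitian] using h.isHermitian
  have hSt : (M.innovCov i s)ᵀ = M.innovCov i s := by
    simpa [IsHermitian] using (M.innovCov_posDef i s).isHermitian
  have hSW : M.innovCov i s = M.sigma22 H2 i r s + H2 i r s * M.R i r * (H2 i r s)ᵀ := by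
    rw [sigma22, innovCov]; abel
  have hGS : G * M.innovCov i s = M.Q (i + 1) s * (M.H (i + 1) s)ᵀ := by
    rw [hG]
    exact nonsing_inv_mul_cancel_right _ _ (M.innovCov_posDef i s).det_pos.ne'.isUnit
  have hHQ : M.H (i + 1) s * M.Q (i + 1) s = M.innovCov i s * Gᵀ := by
    have := congrArg transpose hGS
    rwa [transpose_mul, transpose_mul, transpose_transpose, Q_transpose, hSt, eq_comm] at this
  have hopt : M.optF2 H2 i r s = G * H2 i r s := by rw [hG]; rfl
  have h21 (F : F2Param K m p) (D : Matrix (Fin m) (Fin p) ℝ) (hF : F i r s = D + G * H2 i r s) :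
      M.sigma21 F H2 i r s = M.sigma22 H2 i r s * Gᵀ - H2 i r s * M.R i r * Dᵀ := by
    rw [sigma21, hHQ, hSW, hF, transpose_add, transpose_mul]
    simp only [Matrix.mul_add, Matrix.add_mul, Matrix.mul_assoc]
    abel
  have key (F : F2Param K m p) (D : Matrix (Fin m) (Fin p) ℝ) (hF : F i r s = D + G * H2 i r s) :
      M.schurSigma F H2 i r s + D * M.gainWeight H2 i r s * Dᵀ =
        M.Q (i + 1) s - G * M.innovCov i s * Gᵀ := by
    rw [schurSigma, h21 F D hF, sigma11, gainWeight, hF, hSW]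
    exact schur_complement_identity _ _ _ _ hWt (M.R_transpose i r) h.det_pos.ne'.isUnit
  -- The right side of `key` is free of `D`, so the actual deviation can be compared with deviation
  -- `0`.
  rw [key F2 (F2 i r s - M.optF2 H2 i r s) (by rw [hopt]; abel),
    ← key (M.optF2 H2) 0 (by rw [hopt, zero_add])]
  simp

lemma matSigma_optF2_posDef {F2 : F2Param K m p} {H2 : H2Param K p} {i : ℕ} {r s : Fin K}
    (h : (M.matSigma F2 H2 i r s).PosDef) : (M.matSigma (M.optF2 H2) H2 i r s).PosDef := by
  have hW := M.sigma22_posDef h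
  rw [matSigma, posDef_fromBlocks_transpose_iff _ _ hW] at h ⊢
  change (M.schurSigma (M.optF2 H2) H2 i r s).PosDef
  rw [← M.schurSigma_add (F2 := F2) hW]
  exact PosDef.add_posSemidef h (posSemidef_mul_mul_transpose (M.gainWeight_posDef hW).posSemidef _)

lemma det_matSigma_le_optF2 {F2 : F2Param K m p} {H2 : H2Param K p} {i : ℕ} {r s : Fin K}
    (h : (M.matSigma F2 H2 i r s).PosDef) :
    (M.matSigma F2 H2 i r s).det ≤ (M.matSigma (M.optF2 H2) H2 i r s).det ∧
      ((M.matSigma (M.optF2 H2) H2 i r s).det ≤ (M.matSigma F2 H2 i r s).det →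
        F2 i r s = M.optF2 H2 i r s) := by
  have hW := M.sigma22_posDef h
  have hp := h
  rw [matSigma, posDef_fromBlocks_transpose_iff _ _ hW] at hp
  have hdet (F : F2Param K m p) : (M.matSigma F H2 i r s).det =
      (M.sigma22 H2 i r s).det * (M.schurSigma F H2 i r s).det :=
    det_fromBlocks_transpose _ _ hW
  have hN := M.gainWeight_posDef hW
  have hP : ((F2 i r s - M.optF2 H2 i r s) * M.gainWeight H2 i r s *
      (F2 i r s - M.optF2 H2 i r s)ᵀ).PosSemidef :=
    posSemidef_mul_mul_transpose hN.posSemidef (F2 i r s - M.optF2 H2 i r s)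
  obtain ⟨h1, h2⟩ := det_le_det_add (A := M.schurSigma F2 H2 i r s) hp hP
  rw [M.schurSigma_add hW] at h1 h2
  rw [hdet, hdet, mul_le_mul_iff_right₀ hW.det_pos, mul_le_mul_iff_right₀ hW.det_pos]
  exact ⟨h1, fun h3 => sub_eq_zero.1 (eq_zero_of_mul_mul_transpose_eq_zero hN (h2 h3))⟩

end JMSS

/-! ### Likelihood ratios and divergence of composed kernels -/

section gaussLlr
variable {ι : Type} [Fintype ι] [DecidableEq ι]

/-- Log-likelihood ratio of `𝒩(a, S)` with respect to `𝒩(b, T)`. -/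
def gaussLlr (a : EuclideanSpace ℝ ι) (S : Matrix ι ι ℝ) (b : EuclideanSpace ℝ ι)
    (T : Matrix ι ι ℝ) (v : EuclideanSpace ℝ ι) : ℝ :=
  1 / 2 * Real.log (T.det / S.det) + 1 / 2 * (invQuad T (v - b) - invQuad S (v - a))

lemma lintegral_multivariateGaussian_eq (a b : EuclideanSpace ℝ ι) {S T : Matrix ι ι ℝ}
    (hS : S.PosDef) (hT : T.PosDef) {h : EuclideanSpace ℝ ι → ℝ≥0∞} (hh : Measurable h) :
    ∫⁻ v, h v ∂(multivariateGaussian a S) =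
      ∫⁻ v, ENNReal.ofReal (Real.exp (gaussLlr a S b T v)) * h v ∂(multivariateGaussian b T) := by
  rw [multivariateGaussian_eq_withDensity a hS, multivariateGaussian_eq_withDensity b hT,
    lintegral_withDensity_eq_lintegral_mul _ (by fun_prop) hh,
    lintegral_withDensity_eq_lintegral_mul _ (by fun_prop) (by unfold gaussLlr; fun_prop)]
  refine lintegral_congr fun v => ?_
  have hn := stdNormalizer_pos ι
  simp only [Pi.mul_apply]
  rw [← mul_assoc, ← ENNReal.ofReal_mul (by positivity)]
  congr 2
  have h1 := hS.det_pos
  have h2 := hT.det_pos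
  rw [gaussLlr, Real.exp_add, show 1 / 2 * Real.log (T.det / S.det) = Real.log √(T.det / S.det) by
    rw [Real.log_sqrt (by positivity)]; ring, Real.exp_log (by positivity),
    Real.sqrt_div h2.le]
  have h3 : Real.exp (-(1 / 2) * invQuad S (v - a)) = Real.exp (-(1 / 2) * invQuad T (v - b)) *
      Real.exp (1 / 2 * (invQuad T (v - b) - invQuad S (v - a))) := by
    rw [← Real.exp_add]
    ring_nf
  rw [h3]
  have h4 := (Real.sqrt_pos.2 h2).ne'
  field_simp

end gaussLlr

section divergence
variable {α β : Type*} [MeasurableSpace α] [MeasurableSpace β]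

lemma klDiv_map_of_leftInverse {μ ν : Measure α} [IsFiniteMeasure μ] [IsFiniteMeasure ν]
    {f : α → β} {g : β → α}
    (hf : Measurable f) (hg : Measurable g) (hgf : Function.LeftInverse g f) :
    klDiv (μ.map f) (ν.map f) = klDiv μ ν := by
  refine le_antisymm (klDiv_map_le _ _ hf) ?_
  have h := klDiv_map_le (μ.map f) (ν.map f) hg
  rwa [Measure.map_map hg hf, Measure.map_map hg hf, hgf.comp_eq_id, Measure.map_id,
    Measure.map_id] at h

/-- Fibrewise densities `exp ρ(a, ·)` glue to a density of the joint laws, so `ρ` is the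
log-likelihood ratio almost everywhere. -/
lemma klDiv_compProd_eq_integral {μ : Measure α} [IsProbabilityMeasure μ] {κ η : Kernel α β}
    [IsMarkovKernel κ] [IsMarkovKernel η] {ρ : α × β → ℝ} (hρ : Measurable ρ)
    (hκ : ∀ a, ∀ h : β → ℝ≥0∞, Measurable h →
      ∫⁻ b, h b ∂(κ a) = ∫⁻ b, ENNReal.ofReal (Real.exp (ρ (a, b))) * h b ∂(η a))
    (hint : Integrable ρ (μ ⊗ₘ κ)) :
    klDiv (μ ⊗ₘ κ) (μ ⊗ₘ η) = ENNReal.ofReal (∫ q, ρ q ∂(μ ⊗ₘ κ)) := by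
  have heq : μ ⊗ₘ κ = (μ ⊗ₘ η).withDensity fun q => ENNReal.ofReal (Real.exp (ρ q)) := by
    refine Measure.ext_of_lintegral _ fun h hh => ?_
    rw [lintegral_withDensity_eq_lintegral_mul _ (by fun_prop) hh, Measure.lintegral_compProd hh,
      Measure.lintegral_compProd (by fun_prop)]
    exact lintegral_congr fun a => hκ a _ (by fun_prop)
  have hac : μ ⊗ₘ κ ≪ μ ⊗ₘ η := by
    rw [heq]
    exact withDensity_absolutelyContinuous _ _
  have hllr : llr (μ ⊗ₘ κ) (μ ⊗ₘ η) =ᵐ[μ ⊗ₘ κ] ρ := by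
    have h1 : (μ ⊗ₘ κ).rnDeriv (μ ⊗ₘ η) =ᵐ[μ ⊗ₘ η] fun q => ENNReal.ofReal (Real.exp (ρ q)) := by
      conv_lhs => rw [heq]
      exact Measure.rnDeriv_withDensity _ (by fun_prop)
    filter_upwards [hac.ae_le h1] with q hq
    rw [llr, hq, ENNReal.toReal_ofReal (Real.exp_nonneg _), Real.log_exp]
  rw [klDiv_of_ac_of_integrable hac ((integrable_congr hllr).2 hint), integral_congr_ae hllr]
  simp

/-- Meant for the log-determinant term `c` and two Mahalanobis forms with the same finite mean `d`,
which therefore cancel. -/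
lemma integrable_and_integral_of_lintegral_eq {μ : Measure α} [IsProbabilityMeasure μ]
    {c q q' : α → ℝ} (hc : Measurable c) (hc0 : 0 ≤ c) {C : ℝ} (hcC : ∀ x, c x ≤ C)
    (hq : Measurable q) (hq0 : 0 ≤ q) (hq' : Measurable q') (hq0' : 0 ≤ q') {d : ℝ≥0∞}
    (hd : d ≠ ∞) (h : ∫⁻ x, ENNReal.ofReal (q x) ∂μ = d)
    (h' : ∫⁻ x, ENNReal.ofReal (q' x) ∂μ = d) :
    Integrable (fun x => c x + 1 / 2 * (q x - q' x)) μ ∧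
      ENNReal.ofReal (∫ x, c x + 1 / 2 * (q x - q' x) ∂μ) = ∫⁻ x, ENNReal.ofReal (c x) ∂μ := by
  have hci : Integrable c μ := by
    refine Integrable.of_bound hc.aestronglyMeasurable C (ae_of_all _ fun x => ?_)
    rw [Real.norm_of_nonneg (hc0 x)]
    exact hcC x
  have hqi : Integrable q μ :=
    ⟨hq.aestronglyMeasurable, (hasFiniteIntegral_iff_ofReal (ae_of_all _ hq0)).2
      (h ▸ hd.lt_top)⟩
  have hqi' : Integrable q' μ :=
    ⟨hq'.aestronglyMeasurable, (hasFiniteIntegral_iff_ofReal (ae_of_all _ hq0')).2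
      (h' ▸ hd.lt_top)⟩
  have hd' : Integrable (fun x => 1 / 2 * (q x - q' x)) μ := (hqi.sub hqi').const_mul _
  refine ⟨hci.add hd', ?_⟩
  rw [integral_add hci hd', integral_const_mul, integral_sub hqi hqi',
    integral_eq_lintegral_of_nonneg_ae (ae_of_all _ hq0) hq.aestronglyMeasurable,
    integral_eq_lintegral_of_nonneg_ae (ae_of_all _ hq0') hq'.aestronglyMeasurable, h, h',
    sub_self, mul_zero, add_zero, ofReal_integral_eq_lintegral_ofReal hci (ae_of_all _ hc0)]

end divergence

lemma lintegral_pmf_toMeasure {K : ℕ} (P : PMF (Fin K)) (h : Fin K → ℝ≥0∞) :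
    ∫⁻ s, h s ∂P.toMeasure = ∑ s, P s * h s := by
  rw [lintegral_fintype]
  refine Finset.sum_congr rfl fun s _ => ?_
  rw [P.toMeasure_apply_singleton _ (measurableSet_singleton s), mul_comm]

/-! ### One-step transitions of the two models -/

namespace JMSS
open Matrix
variable {K m p : ℕ} (M : JMSS K m p)

@[simp]
lemma stack_unstack (v : EuclideanSpace ℝ (Fin m ⊕ Fin p)) : stack (unstack v) = v := by
  ext a
  rcases a with a | b <;> rfl

/-- The mean of `z_{i+1}` given `z_i = z`, `r_i = r`, `r_{i+1} = s` in the pairwise chain. -/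
def pmcMean (F2 : F2Param K m p) (H2 : H2Param K p) (i : ℕ) (z : Obs m p) (r s : Fin K) :
    EuclideanSpace ℝ (Fin m ⊕ Fin p) :=
  WithLp.toLp 2 (M.matB F2 H2 i r s *ᵥ WithLp.ofLp (stack z))

/-- The mean of `z_{i+1}` given `x_i = x`, `r_{i+1} = s` in the jump Markov system. -/
def jmssMean (i : ℕ) (x : Vec m) (s : Fin K) : EuclideanSpace ℝ (Fin m ⊕ Fin p) :=
  WithLp.toLp 2 (fromRows 1 (M.H (i + 1) s) *ᵥ (M.F (i + 1) s *ᵥ WithLp.ofLp x))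

lemma pmcMean_eq (F2 : F2Param K m p) (H2 : H2Param K p) (i : ℕ) (x : Vec m) (y : Vec p)
    (r s : Fin K) :
    M.pmcMean F2 H2 i (x, y) r s = WithLp.toLp 2 (gainCol F2 H2 i r s *ᵥ WithLp.ofLp y) +
      M.pmcMean F2 H2 i (x, 0) r s := by
  ext a
  rcases a with a | a <;>
  simp [pmcMean, stack, matB, gainCol, Matrix.fromBlocks_mulVec, Matrix.fromRows_mulVec, add_comm]

/-- At `y_i = H_i x_i`, the mean under `g_i`, the gain terms cancel against the first column of `B`.
-/
lemma gainCol_mulVec_add_pmcMean (F2 : F2Param K m p) (H2 : H2Param K p) (i : ℕ) (x : Vec m)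
    (r s : Fin K) :
    WithLp.toLp 2 (gainCol F2 H2 i r s *ᵥ (M.H i r *ᵥ WithLp.ofLp x)) +
      M.pmcMean F2 H2 i (x, 0) r s = M.jmssMean i x s := by
  ext a
  rcases a with a | a <;>
  simp [pmcMean, jmssMean, stack, matB, gainCol, Matrix.fromBlocks_mulVec, Matrix.fromRows_mulVec,
    Matrix.sub_mulVec]

lemma lintegral_pmcKernel (F2 : F2Param K m p) (H2 : H2Param K p) (i : ℕ) (z : Obs m p)
    (r s : Fin K) {h : Obs m p → ℝ≥0∞} (hh : Measurable h) :
    ∫⁻ z', h z' ∂(M.pmcKernel F2 H2 i (z, (r, s))) =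
      ∫⁻ v, h (unstack v) ∂(multivariateGaussian (M.pmcMean F2 H2 i z r s)
        (M.matSigma F2 H2 i r s)) := by
  rw [pmcKernel, Kernel.lintegral_map _ measurable_unstack _ hh, Kernel.comap_apply]
  rfl

lemma lintegral_jmssKernel_eq (i : ℕ) (x : Vec m) (y : Vec p) (r s : Fin K)
    {h : Obs m p → ℝ≥0∞} (hh : Measurable h) :
    ∫⁻ z', h z' ∂(M.jmssKernel i ((x, y), (r, s))) =
      ∫⁻ x', ∫⁻ y', h (x', y') ∂(M.g (i + 1) (x', s)) ∂(M.f (i + 1) (x, s)) := by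
  rw [jmssKernel, Kernel.lintegral_compProd _ _ _ hh]
  simp [Kernel.comap_apply]

lemma lintegral_jmssKernel (i : ℕ) (x : Vec m) (y : Vec p) (r s : Fin K)
    {h : Obs m p → ℝ≥0∞} (hh : Measurable h) :
    ∫⁻ z', h z' ∂(M.jmssKernel i ((x, y), (r, s))) =
      ∫⁻ v, h (unstack v) ∂(multivariateGaussian (M.jmssMean i x s) (M.jmssSigma i s)) := by
  have hu := hh.comp measurable_unstack
  have key := lintegral_multivariateGaussian_mulVec_add
    (a := WithLp.toLp 2 (M.F (i + 1) s *ᵥ WithLp.ofLp x)) (b := 0)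
    (M.Q_posDef (i + 1) s).posSemidef (M.R_posDef (i + 1) s).posSemidef
    (fromRows 1 (M.H (i + 1) s)) (fromRows (0 : Matrix (Fin m) (Fin p) ℝ) 1) hu
  have hmean : (WithLp.toLp 2 (fromRows 1 (M.H (i + 1) s) *ᵥ (M.F (i + 1) s *ᵥ WithLp.ofLp x)) +
      WithLp.toLp 2 (fromRows (0 : Matrix (Fin m) (Fin p) ℝ) 1 *ᵥ
        WithLp.ofLp (0 : EuclideanSpace ℝ (Fin p)))) = M.jmssMean i x s := by
    simp [jmssMean]
  rw [hmean, ← M.jmssSigma_eq] at key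
  rw [lintegral_jmssKernel_eq _ _ _ _ _ _ hh]
  refine Eq.trans ?_ key
  change ∫⁻ x', _ ∂(multivariateGaussian _ _) = _
  refine lintegral_congr fun x' => ?_
  change ∫⁻ y', _ ∂(multivariateGaussian _ _) = _
  conv_lhs => rw [← add_zero (WithLp.toLp 2 _), multivariateGaussian_add_left]
  rw [lintegral_map (by fun_prop) (by fun_prop)]
  refine lintegral_congr fun y' => ?_
  simp only [Function.comp_apply]
  congr 1
  ext a <;> simp [unstack, Matrix.fromRows_mulVec]

/-- Redrawing `y_i` from `g_i` given `x_i` turns the transition of the pairwise chain into the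
transition of the jump Markov system. -/
lemma lintegral_g_pmcKernel {F2 : F2Param K m p} {H2 : H2Param K p} {i : ℕ} {r s : Fin K}
    (hS : (M.matSigma F2 H2 i r s).PosDef) (x : Vec m) (y : Vec p)
    {h : Obs m p → ℝ≥0∞} (hh : Measurable h) :
    ∫⁻ y', ∫⁻ z', h z' ∂(M.pmcKernel F2 H2 i ((x, y'), (r, s))) ∂(M.g i (x, r)) =
      ∫⁻ z', h z' ∂(M.jmssKernel i ((x, y), (r, s))) := by
  have hu := hh.comp measurable_unstack
  have key := lintegral_multivariateGaussian_mulVec_add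
    (a := WithLp.toLp 2 (M.H i r *ᵥ WithLp.ofLp x)) (b := M.pmcMean F2 H2 i (x, 0) r s)
    (M.R_posDef i r).posSemidef hS.posSemidef (gainCol F2 H2 i r s) 1 hu
  have hmean : (WithLp.toLp 2 (gainCol F2 H2 i r s *ᵥ (M.H i r *ᵥ WithLp.ofLp x)) +
      WithLp.toLp 2 ((1 : Matrix (Fin m ⊕ Fin p) (Fin m ⊕ Fin p) ℝ) *ᵥ
        WithLp.ofLp (M.pmcMean F2 H2 i (x, 0) r s))) = M.jmssMean i x s := by
    rw [Matrix.one_mulVec, ← M.gainCol_mulVec_add_pmcMean F2 H2 i x r s]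
  rw [hmean, transpose_one, Matrix.mul_one, Matrix.one_mul,
    M.gainCol_mul_R_mul_add_matSigma] at key
  rw [lintegral_jmssKernel _ _ _ _ _ _ hh]
  refine Eq.trans ?_ key
  change ∫⁻ y', _ ∂(multivariateGaussian _ _) = _
  refine lintegral_congr fun y' => ?_
  rw [lintegral_pmcKernel _ _ _ _ _ _ _ hh, pmcMean_eq, multivariateGaussian_add_left,
    lintegral_map (f := fun v => h (unstack v)) hu (by fun_prop)]
  simp

lemma lintegral_stepKernel (κ : Kernel (Obs m p × (Fin K × Fin K)) (Obs m p)) [IsMarkovKernel κ]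
    (i : ℕ) (z : Obs m p) (r : Fin K) {h : State K m p → ℝ≥0∞} (hh : Measurable h) :
    ∫⁻ w, h w ∂(M.stepKernel κ i (z, r)) =
      ∑ s, M.trans i r s * ∫⁻ z', h (z', s) ∂(κ (z, (r, s))) := by
  rw [stepKernel, Kernel.lintegral_map _ measurable_swap _ hh,
    Kernel.lintegral_compProd _ _ _ (by fun_prop), Kernel.comap_apply]
  change ∫⁻ s, _ ∂(M.trans i r).toMeasure = _
  rw [lintegral_pmf_toMeasure]
  simp [Kernel.comap_apply]

end JMSS

/-! ### Chain rule on trajectories -/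

section path
variable {S : Type} [MeasurableSpace S] (μ : Measure S) (κ : ℕ → Kernel S S)

/-- The transition of a chain from time `k`, as a kernel on trajectories. -/
def lastKernel (η : Kernel S S) (k : ℕ) : Kernel (Fin (k + 1) → S) S :=
  η.comap (fun t => t (Fin.last k)) (measurable_pi_apply _)

instance (η : Kernel S S) [IsMarkovKernel η] (k : ℕ) : IsMarkovKernel (lastKernel η k) := by
  unfold lastKernel; infer_instance

lemma lintegral_pathLaw_zero {h : S → ℝ≥0∞} (hh : Measurable h) :
    ∫⁻ t, h (t (Fin.last 0)) ∂(pathLaw μ κ 0) = ∫⁻ s, h s ∂μ := by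
  rw [pathLaw, lintegral_map (by fun_prop) (by fun_prop)]

lemma lintegral_pathLaw_succ [IsProbabilityMeasure μ] [∀ i, IsMarkovKernel (κ i)] (k : ℕ)
    {h : S → ℝ≥0∞} (hh : Measurable h) :
    ∫⁻ t, h (t (Fin.last (k + 1))) ∂(pathLaw μ κ (k + 1)) =
      ∫⁻ t, ∫⁻ s, h s ∂(κ k (t (Fin.last k))) ∂(pathLaw μ κ k) := by
  rw [pathLaw, lintegral_map (by fun_prop) (measurable_snoc k)]
  simp only [Fin.snoc_last]
  rw [Measure.lintegral_compProd (by fun_prop)]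
  simp [Kernel.comap_apply]

/-- Appending the last point has a measurable left inverse, so it preserves the divergence of the
composed laws. -/
lemma klDiv_pathLaw_succ [IsProbabilityMeasure μ] (κ' : ℕ → Kernel S S)
    [∀ i, IsMarkovKernel (κ i)] [∀ i, IsMarkovKernel (κ' i)] (k : ℕ) :
    klDiv (pathLaw μ κ (k + 1)) (pathLaw μ κ' (k + 1)) =
      klDiv (pathLaw μ κ k) (pathLaw μ κ' k) +
        klDiv (pathLaw μ κ k ⊗ₘ lastKernel (κ k) k) (pathLaw μ κ k ⊗ₘ lastKernel (κ' k) k) := by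
  rw [← klDiv_compProd_eq_add]
  refine klDiv_map_of_leftInverse (measurable_snoc k)
    (g := fun t => (fun i => t i.castSucc, t (Fin.last (k + 1)))) (by fun_prop) fun q => ?_
  ext <;> simp

end path

lemma measurable_of_regimes {A B C D : Type} [MeasurableSpace A] [MeasurableSpace B]
    [MeasurableSpace C] [MeasurableSingletonClass C] [Countable C] [MeasurableSpace D]
    {f : (A × C) × (B × C) → D} (hf : ∀ r s, Measurable fun w : A × B => f ((w.1, r), (w.2, s))) :
    Measurable f := by
  have h : Measurable fun w : (A × B) × (C × C) => f ((w.1.1, w.2.1), (w.1.2, w.2.2)) :=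
    measurable_from_prod_countable_left fun c => hf c.1 c.2
  exact h.comp (f := fun q : (A × C) × (B × C) => ((q.1.1, q.2.1), (q.1.2, q.2.2))) (by fun_prop)

/-! ### Redrawing the observation, and the step likelihood ratio -/

namespace JMSS
open Matrix
variable {K m p : ℕ} (M : JMSS K m p)

/-- Redraw the observation from `g_i`, given the state and the regime. -/
def redraw (i : ℕ) (h : State K m p → ℝ≥0∞) (w : State K m p) : ℝ≥0∞ :=
  ∫⁻ y, h ((w.1.1, y), w.2) ∂(M.g i (w.1.1, w.2))

lemma measurable_redraw (i : ℕ) {h : State K m p → ℝ≥0∞} (hh : Measurable h) :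
    Measurable (M.redraw i h) := by
  unfold redraw
  have h1 : Measurable fun u : Vec m × Fin K => ∫⁻ y, h ((u.1, y), u.2) ∂(M.g i u) :=
    Measurable.lintegral_kernel_prod_right' (κ := M.g i)
      (f := fun q : (Vec m × Fin K) × Vec p => h ((q.1.1, q.2), q.1.2)) (by fun_prop)
  exact h1.comp (f := fun w : State K m p => (w.1.1, w.2)) (by fun_prop)

lemma measurable_lintegral_stepKernel (κ : Kernel (Obs m p × (Fin K × Fin K)) (Obs m p))
    [IsMarkovKernel κ] (i : ℕ) {h : State K m p → ℝ≥0∞} (hh : Measurable h) :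
    Measurable fun w => ∫⁻ w', h w' ∂(M.stepKernel κ i w) :=
  hh.lintegral_kernel

lemma lintegral_initLaw {h : State K m p → ℝ≥0∞} (hh : Measurable h) :
    ∫⁻ w, h w ∂M.initLaw = ∑ r, M.initRegime r *
      ∫⁻ x, ∫⁻ y, h ((x, y), r) ∂(M.g 0 (x, r)) ∂(multivariateGaussian (M.m0 r) (M.P0 r)) := by
  have : IsMarkovKernel (Kernel.ofFunOfCountable fun r : Fin K =>
      multivariateGaussian (M.m0 r) (M.P0 r)) :=
    ⟨fun _ => inferInstanceAs (IsProbabilityMeasure (multivariateGaussian _ _))⟩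
  rw [initLaw, lintegral_map hh measurable_swap, Measure.lintegral_compProd (by fun_prop),
    lintegral_pmf_toMeasure]
  refine Finset.sum_congr rfl fun r _ => ?_
  rw [z0Kernel, Kernel.lintegral_compProd _ _ _ (by fun_prop)]
  rfl

variable {F2 : F2Param K m p} {H2 : H2Param K p}

lemma lintegral_redraw_stepKernel_jmssKernel (i : ℕ) (w : State K m p) {h : State K m p → ℝ≥0∞}
    (hh : Measurable h) :
    ∫⁻ w', M.redraw (i + 1) h w' ∂(M.stepKernel (M.jmssKernel i) i w) =
      ∫⁻ w', h w' ∂(M.stepKernel (M.jmssKernel i) i w) := by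
  obtain ⟨⟨x, y⟩, r⟩ := w
  rw [lintegral_stepKernel _ _ _ _ _ (M.measurable_redraw _ hh), lintegral_stepKernel _ _ _ _ _ hh]
  refine Finset.sum_congr rfl fun s _ => ?_
  rw [lintegral_jmssKernel_eq _ _ _ _ _ _ (h := fun z' => M.redraw (i + 1) h (z', s))
      ((M.measurable_redraw _ hh).comp measurable_prodMk_right),
    lintegral_jmssKernel_eq _ _ _ _ _ _ (h := fun z' => h (z', s)) (by fun_prop)]
  simp [redraw]

lemma redraw_lintegral_stepKernel (hS : M.IsAdmissible F2 H2) (i : ℕ) (w : State K m p)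
    {h : State K m p → ℝ≥0∞} (hh : Measurable h) :
    M.redraw i (fun w => ∫⁻ w', h w' ∂(M.stepKernel (M.pmcKernel F2 H2 i) i w)) w =
      ∫⁻ w', h w' ∂(M.stepKernel (M.jmssKernel i) i w) := by
  obtain ⟨⟨x, y⟩, r⟩ := w
  simp only [redraw]
  simp_rw [lintegral_stepKernel _ _ _ _ _ hh]
  have hmeas (s : Fin K) : Measurable fun y' : Vec p =>
      ∫⁻ z', h (z', s) ∂(M.pmcKernel F2 H2 i ((x, y'), (r, s))) := by
    have h1 : Measurable fun u => ∫⁻ z', h (z', s) ∂(M.pmcKernel F2 H2 i u) :=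
      Measurable.lintegral_kernel (f := fun z' => h (z', s)) (by fun_prop)
    exact h1.comp (f := fun y' : Vec p => ((x, y'), (r, s))) (by fun_prop)
  rw [lintegral_finsetSum _ fun s _ => (hmeas s).const_mul _]
  refine Finset.sum_congr rfl fun s _ => ?_
  rw [lintegral_const_mul _ (hmeas s), M.lintegral_g_pmcKernel (hS i r s) x y
    (h := fun z' => h (z', s)) (by fun_prop)]

/-- In the pairwise chain, as in the jump Markov system, the law of `y_k` given `(x_k, r_k)`
is `g_k`. -/
lemma lintegral_redraw_pmcLaw (hS : M.IsAdmissible F2 H2) (k : ℕ) {h : State K m p → ℝ≥0∞}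
    (hh : Measurable h) :
    ∫⁻ t, M.redraw k h (t (Fin.last k)) ∂(M.pmcLaw F2 H2 k) =
      ∫⁻ t, h (t (Fin.last k)) ∂(M.pmcLaw F2 H2 k) := by
  induction k generalizing h with
  | zero =>
    rw [pmcLaw, lintegral_pathLaw_zero _ _ hh,
      lintegral_pathLaw_zero _ _ (M.measurable_redraw _ hh), lintegral_initLaw _ hh,
      lintegral_initLaw _ (M.measurable_redraw _ hh)]
    simp [redraw]
  | succ k ih =>
    have hr := M.measurable_redraw (k + 1) hh
    -- The induction hypothesis allows `y_k` to be redrawn, which replaces the last pairwise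
    -- transition by that of the jump system.
    have key {h' : State K m p → ℝ≥0∞} (hh' : Measurable h') :
        ∫⁻ t, h' (t (Fin.last (k + 1))) ∂(M.pmcLaw F2 H2 (k + 1)) =
          ∫⁻ t, ∫⁻ w', h' w' ∂(M.stepKernel (M.jmssKernel k) k (t (Fin.last k)))
            ∂(M.pmcLaw F2 H2 k) := by
      rw [pmcLaw, lintegral_pathLaw_succ _ _ _ hh', ← pmcLaw,
        ← ih (h := fun w => ∫⁻ w', h' w' ∂(M.stepKernel (M.pmcKernel F2 H2 k) k w))
          (M.measurable_lintegral_stepKernel _ _ hh')]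
      simp_rw [M.redraw_lintegral_stepKernel hS k _ hh']
    rw [key hr, key hh]
    simp_rw [M.lintegral_redraw_stepKernel_jmssKernel _ _ hh]

/-- The regimes evolve on their own, so the weights in the divergence do not depend on `(F2, H2)`.
-/
lemma lintegral_regime_pmcLaw (k : ℕ) (h : Fin K → ℝ≥0∞) :
    ∫⁻ t, h (t (Fin.last k)).2 ∂(M.pmcLaw F2 H2 k) = ∑ r, M.regimeLaw k r * h r := by
  induction k generalizing h with
  | zero =>
    rw [pmcLaw, lintegral_pathLaw_zero _ _ (h := fun w : State K m p => h w.2) (by fun_prop),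
      lintegral_initLaw _ (by fun_prop)]
    simp [regimeLaw]
  | succ k ih =>
    rw [pmcLaw, lintegral_pathLaw_succ _ _ _ (h := fun w : State K m p => h w.2) (by fun_prop),
      ← pmcLaw]
    have h1 (w : State K m p) : ∫⁻ w', h w'.2 ∂(M.stepKernel (M.pmcKernel F2 H2 k) k w) =
        ∑ s, M.trans k w.2 s * h s := by
      obtain ⟨z, r⟩ := w
      rw [lintegral_stepKernel _ _ _ _ _ (by fun_prop)]
      simp
    simp_rw [h1]
    rw [ih fun r => ∑ s, M.trans k r s * h s]
    simp_rw [regimeLaw, PMF.bind_apply, tsum_fintype, Finset.mul_sum, Finset.sum_mul]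
    rw [Finset.sum_comm]
    simp_rw [mul_assoc]

/-- Half the logarithm of the ratio of the determinants of the conditional covariances. -/
def logDetGap (F2 : F2Param K m p) (H2 : H2Param K p) (i : ℕ) (r s : Fin K) : ℝ :=
  1 / 2 * Real.log ((M.jmssSigma i s).det / (M.matSigma F2 H2 i r s).det)

lemma logDetGap_nonneg {i : ℕ} {r s : Fin K} (hS : (M.matSigma F2 H2 i r s).PosDef) :
    0 ≤ M.logDetGap F2 H2 i r s :=
  mul_nonneg (by norm_num) (Real.log_nonneg
    ((one_le_div hS.det_pos).2 (M.det_matSigma_le _ _ _ _ _ hS)))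

/-- Log-likelihood ratio of the transitions of `(z, r)` in the two models. -/
def stepLlr (F2 : F2Param K m p) (H2 : H2Param K p) (i : ℕ) (q : State K m p × State K m p) : ℝ :=
  gaussLlr (M.pmcMean F2 H2 i q.1.1 q.1.2 q.2.2) (M.matSigma F2 H2 i q.1.2 q.2.2)
    (M.jmssMean i q.1.1.1 q.2.2) (M.jmssSigma i q.2.2) (stack q.2.1)

lemma measurable_pmcMean (i : ℕ) (r s : Fin K) :
    Measurable fun z => M.pmcMean F2 H2 i z r s :=
  (measurable_toLp_mulVec _).comp measurable_stack

lemma measurable_jmssMean (i : ℕ) (s : Fin K) : Measurable fun x => M.jmssMean i x s :=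
  (measurable_toLp_mulVec (fromRows 1 (M.H (i + 1) s))).comp
    (measurable_toLp_mulVec (M.F (i + 1) s))

/-- Squared Mahalanobis distance of `z_{i+1}` to its conditional mean in the pairwise chain. -/
def pmcQuad (F2 : F2Param K m p) (H2 : H2Param K p) (i : ℕ) (q : State K m p × State K m p) : ℝ :=
  invQuad (M.matSigma F2 H2 i q.1.2 q.2.2) (stack q.2.1 - M.pmcMean F2 H2 i q.1.1 q.1.2 q.2.2)

/-- Squared Mahalanobis distance of `z_{i+1}` to its conditional mean in the jump system. -/
def jmssQuad (i : ℕ) (q : State K m p × State K m p) : ℝ :=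
  invQuad (M.jmssSigma i q.2.2) (stack q.2.1 - M.jmssMean i q.1.1.1 q.2.2)

lemma measurable_pmcQuad (i : ℕ) : Measurable (M.pmcQuad F2 H2 i) := by
  refine measurable_of_regimes fun r s => ?_
  have h := M.measurable_pmcMean (F2 := F2) (H2 := H2) i r s
  have hs := measurable_stack (m := m) (p := p)
  have key : Measurable fun w : Obs m p × Obs m p =>
      invQuad (M.matSigma F2 H2 i r s) (stack w.2 - M.pmcMean F2 H2 i w.1 r s) :=
    (continuous_invQuad _).measurable.comp
      ((hs.comp measurable_snd).sub (h.comp measurable_fst))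
  exact key

lemma measurable_jmssQuad (i : ℕ) : Measurable (M.jmssQuad i) := by
  refine measurable_of_regimes fun r s => ?_
  have h := M.measurable_jmssMean i s
  have hs := measurable_stack (m := m) (p := p)
  have key : Measurable fun w : Obs m p × Obs m p =>
      invQuad (M.jmssSigma i s) (stack w.2 - M.jmssMean i w.1.1 s) :=
    (continuous_invQuad _).measurable.comp
      ((hs.comp measurable_snd).sub (h.comp (measurable_fst.comp measurable_fst)))
  exact key

lemma stepLlr_eq (i : ℕ) (q : State K m p × State K m p) : M.stepLlr F2 H2 i q =
    M.logDetGap F2 H2 i q.1.2 q.2.2 + 1 / 2 * (M.jmssQuad i q - M.pmcQuad F2 H2 i q) := rfl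

lemma measurable_logDetGap (i : ℕ) : Measurable fun q : State K m p × State K m p =>
    M.logDetGap F2 H2 i q.1.2 q.2.2 :=
  measurable_of_regimes fun _ _ => by dsimp only; exact measurable_const

lemma measurable_stepLlr (i : ℕ) : Measurable (M.stepLlr F2 H2 i) := by
  have h1 := M.measurable_pmcQuad (F2 := F2) (H2 := H2) i
  have h2 := M.measurable_jmssQuad i
  have h3 := M.measurable_logDetGap (F2 := F2) (H2 := H2) i
  simp_rw [funext (M.stepLlr_eq i)]
  exact h3.add ((h2.sub h1).const_mul _)

/-- Both models use the same regime probabilities, so only the Gaussian ratio remains. -/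
lemma lintegral_stepKernel_pmcKernel (hS : M.IsAdmissible F2 H2) (i : ℕ) (w : State K m p)
    {h : State K m p → ℝ≥0∞} (hh : Measurable h) :
    ∫⁻ w', h w' ∂(M.stepKernel (M.pmcKernel F2 H2 i) i w) =
      ∫⁻ w', ENNReal.ofReal (Real.exp (M.stepLlr F2 H2 i (w, w'))) * h w'
        ∂(M.stepKernel (M.jmssKernel i) i w) := by
  have hl := M.measurable_stepLlr (F2 := F2) (H2 := H2) i
  obtain ⟨⟨x, y⟩, r⟩ := w
  rw [lintegral_stepKernel _ _ _ _ _ hh, lintegral_stepKernel _ _ _ _ _ (by fun_prop)]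
  refine Finset.sum_congr rfl fun s _ => ?_
  rw [lintegral_pmcKernel _ _ _ _ _ _ _ (by fun_prop),
    lintegral_jmssKernel _ _ _ _ _ _ (by fun_prop),
    lintegral_multivariateGaussian_eq _ (M.jmssMean i x s) (hS i r s) (M.jmssSigma_posDef i s)
      (h := fun v => h (unstack v, s))
      (hh.comp (measurable_prodMk_right.comp measurable_unstack))]
  simp only [stepLlr, stack_unstack]

lemma sum_trans (i : ℕ) (r : Fin K) (c : ℝ≥0∞) : ∑ s, M.trans i r s * c = c := by
  rw [← Finset.sum_mul, ← tsum_fintype (L := .unconditional _), PMF.tsum_coe, one_mul]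

lemma lintegral_stepKernel_pmcQuad (hS : M.IsAdmissible F2 H2) (i : ℕ) (w : State K m p) :
    ∫⁻ w', ENNReal.ofReal (M.pmcQuad F2 H2 i (w, w')) ∂(M.stepKernel (M.pmcKernel F2 H2 i) i w) =
      Fintype.card (Fin m ⊕ Fin p) := by
  have hq := M.measurable_pmcQuad (F2 := F2) (H2 := H2) i
  obtain ⟨⟨x, y⟩, r⟩ := w
  rw [lintegral_stepKernel _ _ _ _ _ (by fun_prop), ← M.sum_trans i r (Fintype.card _)]
  refine Finset.sum_congr rfl fun s _ => ?_
  rw [lintegral_pmcKernel _ _ _ _ _ _ _ (by fun_prop), 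
    ← lintegral_invQuad (M.pmcMean F2 H2 i (x, y) r s) (hS i r s)]
  simp only [pmcQuad, stack_unstack]

lemma lintegral_stepKernel_jmssQuad (i : ℕ) (w : State K m p) :
    ∫⁻ w', ENNReal.ofReal (M.jmssQuad i (w, w')) ∂(M.stepKernel (M.jmssKernel i) i w) =
      Fintype.card (Fin m ⊕ Fin p) := by
  have hq := M.measurable_jmssQuad i
  obtain ⟨⟨x, y⟩, r⟩ := w
  rw [lintegral_stepKernel _ _ _ _ _ (by fun_prop), ← M.sum_trans i r (Fintype.card _)]
  refine Finset.sum_congr rfl fun s _ => ?_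
  rw [lintegral_jmssKernel _ _ _ _ _ _ (by fun_prop),
    ← lintegral_invQuad (M.jmssMean i x s) (M.jmssSigma_posDef i s)]
  simp only [jmssQuad, stack_unstack]

end JMSS

/-! ### The divergence as a sum of log-determinant gaps -/

namespace JMSS
open Matrix
variable {K m p : ℕ} (M : JMSS K m p) {F2 : F2Param K m p} {H2 : H2Param K p}

instance (k : ℕ) : IsProbabilityMeasure (M.pmcLaw F2 H2 k) := by
  unfold pmcLaw; infer_instance

lemma measurable_lastPair (k : ℕ) : Measurable
    fun q : (Fin (k + 1) → State K m p) × State K m p => (q.1 (Fin.last k), q.2) :=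
  ((measurable_pi_apply _).comp measurable_fst).prodMk measurable_snd

lemma lintegral_pmcLaw_compProd (k : ℕ) {h : State K m p × State K m p → ℝ≥0∞}
    (hh : Measurable h) :
    ∫⁻ q, h (q.1 (Fin.last k), q.2)
        ∂(M.pmcLaw F2 H2 k ⊗ₘ lastKernel (M.stepKernel (M.pmcKernel F2 H2 k) k) k) =
      ∫⁻ t, ∫⁻ w', h (t (Fin.last k), w')
        ∂(M.stepKernel (M.pmcKernel F2 H2 k) k (t (Fin.last k))) ∂(M.pmcLaw F2 H2 k) := by
  have hh' : Measurable fun q : (Fin (k + 1) → State K m p) × State K m p =>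
    h (q.1 (Fin.last k), q.2) := hh.comp (measurable_lastPair k)
  rw [Measure.lintegral_compProd hh']
  simp only [lastKernel, Kernel.comap_apply]

lemma lintegral_pmcQuad (hS : M.IsAdmissible F2 H2) (k : ℕ) :
    ∫⁻ q, ENNReal.ofReal (M.pmcQuad F2 H2 k (q.1 (Fin.last k), q.2))
        ∂(M.pmcLaw F2 H2 k ⊗ₘ lastKernel (M.stepKernel (M.pmcKernel F2 H2 k) k) k) =
      Fintype.card (Fin m ⊕ Fin p) := by
  have hq := M.measurable_pmcQuad (F2 := F2) (H2 := H2) k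
  rw [M.lintegral_pmcLaw_compProd k (h := fun q => ENNReal.ofReal (M.pmcQuad F2 H2 k q))
    hq.ennreal_ofReal]
  simp_rw [M.lintegral_stepKernel_pmcQuad hS]
  rw [lintegral_const, measure_univ, mul_one]

/-- The conditional mean given `z_k` may vary with `y_k`. Redrawing `y_k` turns it into the mean
under the jump system, which is the dimension. -/
lemma lintegral_jmssQuad (hS : M.IsAdmissible F2 H2) (k : ℕ) :
    ∫⁻ q, ENNReal.ofReal (M.jmssQuad k (q.1 (Fin.last k), q.2))
        ∂(M.pmcLaw F2 H2 k ⊗ₘ lastKernel (M.stepKernel (M.pmcKernel F2 H2 k) k) k) =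
      Fintype.card (Fin m ⊕ Fin p) := by
  have hq := M.measurable_jmssQuad k
  rw [M.lintegral_pmcLaw_compProd k (h := fun q => ENNReal.ofReal (M.jmssQuad k q))
    hq.ennreal_ofReal, ← M.lintegral_redraw_pmcLaw hS k
      (h := fun w => ∫⁻ w', ENNReal.ofReal (M.jmssQuad k (w, w'))
        ∂(M.stepKernel (M.pmcKernel F2 H2 k) k w))
      (Measurable.lintegral_kernel_prod_right'
        (f := fun q => ENNReal.ofReal (M.jmssQuad k q)) hq.ennreal_ofReal)]
  have key (w : State K m p) : M.redraw k (fun w => ∫⁻ w', ENNReal.ofReal (M.jmssQuad k (w, w'))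
      ∂(M.stepKernel (M.pmcKernel F2 H2 k) k w)) w = Fintype.card (Fin m ⊕ Fin p) := by
    obtain ⟨⟨x, y⟩, r⟩ := w
    rw [← M.lintegral_stepKernel_jmssQuad k ((x, y), r),
      ← M.redraw_lintegral_stepKernel hS k ((x, y), r)
        (h := fun w' => ENNReal.ofReal (M.jmssQuad k (((x, y), r), w')))
        (hq.comp measurable_prodMk_left).ennreal_ofReal]
    -- The form depends on the past only through `x_k` and `r_k`, so redrawing `y_k` leaves the
    -- integrand unchanged.
    simp only [redraw, jmssQuad]
  simp_rw [key]
  rw [lintegral_const, measure_univ, mul_one]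

lemma lintegral_logDetGap (k : ℕ) :
    ∫⁻ q, ENNReal.ofReal (M.logDetGap F2 H2 k (q.1 (Fin.last k)).2 q.2.2)
        ∂(M.pmcLaw F2 H2 k ⊗ₘ lastKernel (M.stepKernel (M.pmcKernel F2 H2 k) k) k) =
      ∑ r, M.regimeLaw k r *
        ∑ s, M.trans k r s * ENNReal.ofReal (M.logDetGap F2 H2 k r s) := by
  have hq := M.measurable_logDetGap (F2 := F2) (H2 := H2) k
  rw [M.lintegral_pmcLaw_compProd k
    (h := fun q => ENNReal.ofReal (M.logDetGap F2 H2 k q.1.2 q.2.2)) hq.ennreal_ofReal,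
    ← M.lintegral_regime_pmcLaw (F2 := F2) (H2 := H2)]
  refine lintegral_congr fun t => ?_
  obtain ⟨z, r⟩ := t (Fin.last k)
  have hg : Measurable fun w' : State K m p => ENNReal.ofReal (M.logDetGap F2 H2 k r w'.2) :=
    (measurable_of_finite fun s => ENNReal.ofReal (M.logDetGap F2 H2 k r s)).comp measurable_snd
  rw [lintegral_stepKernel _ _ _ _ _ hg]
  simp

lemma pmcQuad_nonneg (hS : M.IsAdmissible F2 H2) (i : ℕ) (q : State K m p × State K m p) :
    0 ≤ M.pmcQuad F2 H2 i q :=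
  invQuad_nonneg (hS _ _ _) _

lemma jmssQuad_nonneg (i : ℕ) (q : State K m p × State K m p) : 0 ≤ M.jmssQuad i q :=
  invQuad_nonneg (M.jmssSigma_posDef _ _) _

lemma kld_zero : M.kld 0 F2 H2 = 0 :=
  klDiv_self (M.pmcLaw F2 H2 0)

lemma klDiv_pmcLaw_compProd (hS : M.IsAdmissible F2 H2) (k : ℕ) :
    klDiv (M.pmcLaw F2 H2 k ⊗ₘ lastKernel (M.stepKernel (M.pmcKernel F2 H2 k) k) k)
        (M.pmcLaw F2 H2 k ⊗ₘ lastKernel (M.stepKernel (M.jmssKernel k) k) k) =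
      ∑ r, M.regimeLaw k r * ∑ s, M.trans k r s * ENNReal.ofReal (M.logDetGap F2 H2 k r s) := by
  have hpair := measurable_lastPair (K := K) (m := m) (p := p) k
  have hl : Measurable fun q : (Fin (k + 1) → State K m p) × State K m p =>
    M.stepLlr F2 H2 k (q.1 (Fin.last k), q.2) :=
      (M.measurable_stepLlr (F2 := F2) (H2 := H2) k).comp hpair
  have hq : Measurable fun q : (Fin (k + 1) → State K m p) × State K m p =>
    M.pmcQuad F2 H2 k (q.1 (Fin.last k), q.2) :=
      (M.measurable_pmcQuad (F2 := F2) (H2 := H2) k).comp hpair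
  have hq' : Measurable fun q : (Fin (k + 1) → State K m p) × State K m p =>
    M.jmssQuad k (q.1 (Fin.last k), q.2) := (M.measurable_jmssQuad k).comp hpair
  have hc : Measurable fun q : (Fin (k + 1) → State K m p) × State K m p =>
    M.logDetGap F2 H2 k (q.1 (Fin.last k)).2 q.2.2 := by
    have h := (M.measurable_logDetGap (F2 := F2) (H2 := H2) k).comp hpair
    simpa only [Function.comp_def] using h
  -- A crude uniform bound over the finitely many regime pairs, needed only for integrability.
  have hbound (r s : Fin K) :
      M.logDetGap F2 H2 k r s ≤ ∑ r, ∑ s, M.logDetGap F2 H2 k r s :=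
    (Finset.single_le_sum (f := fun s => M.logDetGap F2 H2 k r s)
        (fun s _ => M.logDetGap_nonneg (hS _ _ _)) (Finset.mem_univ s)).trans
      (Finset.single_le_sum (f := fun r => ∑ s, M.logDetGap F2 H2 k r s)
        (fun r _ => Finset.sum_nonneg fun s _ => M.logDetGap_nonneg (hS _ _ _))
        (Finset.mem_univ r))
  obtain ⟨hint, hval⟩ := integrable_and_integral_of_lintegral_eq hc
    (fun q => M.logDetGap_nonneg (hS _ _ _)) (fun q => hbound _ _)
    hq' (fun q => M.jmssQuad_nonneg k _)
    hq (fun q => M.pmcQuad_nonneg hS k _)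
    (ENNReal.natCast_ne_top _) (M.lintegral_jmssQuad hS k) (M.lintegral_pmcQuad hS k)
  rw [M.lintegral_logDetGap] at hval
  simp only [M.stepLlr_eq] at hl
  rw [← hval]
  refine klDiv_compProd_eq_integral hl (fun t h hh => ?_) hint
  simp only [lastKernel, Kernel.comap_apply]
  exact M.lintegral_stepKernel_pmcKernel hS k (t (Fin.last k)) hh

lemma kld_succ (hS : M.IsAdmissible F2 H2) (k : ℕ) :
    M.kld (k + 1) F2 H2 = M.kld k F2 H2 + ∑ r, M.regimeLaw k r *
      ∑ s, M.trans k r s * ENNReal.ofReal (M.logDetGap F2 H2 k r s) := by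
  rw [← M.klDiv_pmcLaw_compProd hS]
  exact klDiv_pathLaw_succ _ _ _ k

lemma kld_eq_sum (hS : M.IsAdmissible F2 H2) (k : ℕ) :
    M.kld k F2 H2 = ∑ i ∈ Finset.range k, ∑ r, M.regimeLaw i r *
      ∑ s, M.trans i r s * ENNReal.ofReal (M.logDetGap F2 H2 i r s) := by
  induction k with
  | zero => simpa using M.kld_zero
  | succ k ih => rw [M.kld_succ hS, ih, Finset.sum_range_succ]

lemma kld_ne_top (hS : M.IsAdmissible F2 H2) (k : ℕ) : M.kld k F2 H2 ≠ ∞ := by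
  rw [M.kld_eq_sum hS]
  refine ENNReal.sum_ne_top.2 fun i _ => ENNReal.sum_ne_top.2 fun r _ =>
    ENNReal.mul_ne_top (PMF.apply_ne_top _ _) (ENNReal.sum_ne_top.2 fun s _ =>
      ENNReal.mul_ne_top (PMF.apply_ne_top _ _) ENNReal.ofReal_ne_top)

/-! ### Minimization over the gain -/

lemma isAdmissible_optF2 (hS : M.IsAdmissible F2 H2) : M.IsAdmissible (M.optF2 H2) H2 :=
  fun i r s => M.matSigma_optF2_posDef (hS i r s)

lemma logDetGap_le_iff {F2' : F2Param K m p} {i : ℕ} {r s : Fin K}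
    (h : (M.matSigma F2 H2 i r s).PosDef) (h' : (M.matSigma F2' H2 i r s).PosDef) :
    M.logDetGap F2 H2 i r s ≤ M.logDetGap F2' H2 i r s ↔
      (M.matSigma F2' H2 i r s).det ≤ (M.matSigma F2 H2 i r s).det := by
  have h0 := (M.jmssSigma_posDef i s).det_pos
  have h1 := h.det_pos
  have h2 := h'.det_pos
  rw [logDetGap, logDetGap, mul_le_mul_iff_right₀ (by norm_num),
    Real.log_le_log_iff (by positivity) (by positivity), div_le_div_iff_of_pos_left h0 h1 h2]

lemma logDetGap_optF2_le (hS : M.IsAdmissible F2 H2) (i : ℕ) (r s : Fin K) :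
    M.logDetGap (M.optF2 H2) H2 i r s ≤ M.logDetGap F2 H2 i r s :=
  (M.logDetGap_le_iff (M.isAdmissible_optF2 hS i r s) (hS i r s)).2
    (M.det_matSigma_le_optF2 (hS i r s)).1

lemma kld_optF2_le (hS : M.IsAdmissible F2 H2) (k : ℕ) :
    M.kld k (M.optF2 H2) H2 ≤ M.kld k F2 H2 := by
  rw [M.kld_eq_sum hS, M.kld_eq_sum (M.isAdmissible_optF2 hS)]
  gcongr
  exact M.logDetGap_optF2_le hS _ _ _

lemma toReal_kld (hS : M.IsAdmissible F2 H2) (k : ℕ) :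
    (M.kld k F2 H2).toReal = ∑ i ∈ Finset.range k, ∑ r, (M.regimeLaw i r).toReal *
      ∑ s, (M.trans i r s).toReal * M.logDetGap F2 H2 i r s := by
  have hs (i : ℕ) (r : Fin K) :
      ∑ s, M.trans i r s * ENNReal.ofReal (M.logDetGap F2 H2 i r s) ≠ ∞ :=
    ENNReal.sum_ne_top.2 fun s _ => ENNReal.mul_ne_top (PMF.apply_ne_top _ _) ENNReal.ofReal_ne_top
  have hr (i : ℕ) (r : Fin K) := ENNReal.mul_ne_top ((M.regimeLaw i).apply_ne_top r) (hs i r)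
  rw [M.kld_eq_sum hS, ENNReal.toReal_sum fun i _ => ENNReal.sum_ne_top.2 fun r _ => hr i r]
  refine Finset.sum_congr rfl fun i _ => ?_
  rw [ENNReal.toReal_sum fun r _ => hr i r]
  refine Finset.sum_congr rfl fun r _ => ?_
  rw [ENNReal.toReal_mul, ENNReal.toReal_sum fun s _ =>
    ENNReal.mul_ne_top (PMF.apply_ne_top _ _) ENNReal.ofReal_ne_top]
  simp_rw [ENNReal.toReal_mul, ENNReal.toReal_ofReal (M.logDetGap_nonneg (hS _ _ _))]

/-- The optimum is best term by term, so equality of the finite sums forces equality of every term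
of positive weight; the determinants then agree and the gain is optimal. Conversely, terms of zero
weight vanish. -/
lemma kld_le_optF2_iff (hS : M.IsAdmissible F2 H2) (k : ℕ) :
    M.kld k F2 H2 ≤ M.kld k (M.optF2 H2) H2 ↔ M.AgreeUpTo k F2 (M.optF2 H2) := by
  have hO := M.isAdmissible_optF2 hS
  constructor
  · intro hle i hi r s hr hs
    -- Real sums allow termwise equality and cancellation of the nonzero weights.
    have heq := congrArg ENNReal.toReal (le_antisymm (M.kld_optF2_le hS k) hle)
    rw [M.toReal_kld hS, M.toReal_kld hO] at heq
    have hin (i : ℕ) (r s : Fin K) := mul_le_mul_of_nonneg_left (M.logDetGap_optF2_le hS i r s)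
      (ENNReal.toReal_nonneg (a := M.trans i r s))
    have hmid (i : ℕ) (r : Fin K) := mul_le_mul_of_nonneg_left
      (Finset.sum_le_sum fun s (_ : s ∈ Finset.univ) => hin i r s)
      (ENNReal.toReal_nonneg (a := M.regimeLaw i r))
    have h1 := (Finset.sum_eq_sum_iff_of_le fun i _ =>
      Finset.sum_le_sum fun r (_ : r ∈ Finset.univ) => hmid i r).1 heq i (Finset.mem_range.2 hi)
    have h2 := (Finset.sum_eq_sum_iff_of_le fun r _ => hmid i r).1 h1 r (Finset.mem_univ _)
    have h3 := mul_left_cancel₀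
      (ENNReal.toReal_ne_zero.2 ⟨hr, (M.regimeLaw i).apply_ne_top r⟩) h2
    have h4 := (Finset.sum_eq_sum_iff_of_le fun s _ => hin i r s).1 h3 s (Finset.mem_univ _)
    have h5 := mul_left_cancel₀
      (ENNReal.toReal_ne_zero.2 ⟨hs, (M.trans i r).apply_ne_top s⟩) h4
    exact (M.det_matSigma_le_optF2 (hS i r s)).2
      ((M.logDetGap_le_iff (hS i r s) (hO i r s)).1 h5.ge)
  · intro hag
    rw [M.kld_eq_sum hS, M.kld_eq_sum hO]
    refine le_of_eq (Finset.sum_congr rfl fun i hi => Finset.sum_congr rfl fun r _ => ?_)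
    rcases eq_or_ne (M.regimeLaw i r) 0 with hr | hr
    · rw [hr, zero_mul, zero_mul]
    congr 1
    refine Finset.sum_congr rfl fun s _ => ?_
    rcases eq_or_ne (M.trans i r s) 0 with hs | hs
    · rw [hs, zero_mul, zero_mul]
    have h := hag i (Finset.mem_range.1 hi) r s hr hs
    simp only [logDetGap, matSigma, sigma11, sigma21, h]

end JMSS
end JumpPMC

end

theorem mainTheorem5 {K m p : ℕ} (M : JumpPMC.JMSS K m p) :
    (∀ H2 : JumpPMC.H2Param K p,
      (∃ F2 : JumpPMC.F2Param K m p, (F2, H2) ∈ M.constrainedClass) →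
        (M.optF2 H2, H2) ∈ M.constrainedClass ∧
        ∀ k : ℕ,
          M.kld k (M.optF2 H2) H2 ≠ ∞ ∧
          ∀ F2 : JumpPMC.F2Param K m p, (F2, H2) ∈ M.constrainedClass →
            (IsMinOn (fun F2' => M.kld k F2' H2) {F2' | (F2', H2) ∈ M.constrainedClass} F2 ↔
              M.AgreeUpTo k F2 (M.optF2 H2))) ∧
    (∀ (k : ℕ) (F2 : JumpPMC.F2Param K m p) (H2 : JumpPMC.H2Param K p),
      (F2, H2) ∈ M.constrainedClass →
        IsMinOn (fun θ => M.kld k θ.1 θ.2) M.constrainedClass (F2, H2) →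
          M.AgreeUpTo k F2 (M.optF2 H2)) := by
  have hopt {F2 : JumpPMC.F2Param K m p} {H2 : JumpPMC.H2Param K p}
      (h : (F2, H2) ∈ M.constrainedClass) : (M.optF2 H2, H2) ∈ M.constrainedClass :=
    ⟨M.isAdmissible_optF2 h.1, h.2⟩
  constructor
  · rintro H2 ⟨F2₀, h⟩
    refine ⟨hopt h, fun k => ⟨M.kld_ne_top (hopt h).1 k, fun F2 hF2 => ?_⟩⟩
    rw [← M.kld_le_optF2_iff hF2.1 k, isMinOn_iff]
    constructor
    · intro hmin
      exact hmin (M.optF2 H2) (hopt h)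
    · intro hle F2' hF2'
      exact hle.trans (M.kld_optF2_le hF2'.1 k)
  · intro k F2 H2 h hmin
    rw [← M.kld_le_optF2_iff h.1 k]
    -- The only competitor needed keeps the same `H2`.
    exact isMinOn_iff.1 hmin (M.optF2 H2, H2) (hopt h)
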